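/- Let $\mathbb{F}$ be a field, let $\ell \geq 0$ be an integer, and let $Q$ be the equioriented quiver $x_0 \to x_1 \to \cdots \to x_\ell$ of type $\mathbb{A}_\ell$. Its finite-dimensional representations over $\mathbb{F}$ are called ordinary persistence modules. A central charge is a function $\alpha : \{x_0,\ldots,x_\ell\} \to \mathbb{R}$, and the $\alpha$-slope of a nonzero representation $V$ is $$\mu_\alpha(V) = \frac{\sum_i \alpha(x_i)\dim V_{x_i}}{\sum_i \dim V_{x_i}}.$$ A nonzero $V$ is $\alpha$-semistable if $\mu_\alpha(U) \leq \mu_\alpha(V)$ for every nonzero subrepresentation $U \subset V$. The Harder–Narasimhan filtration of $V$ along $\alpha$ is the unique filtration $0 = V^0 \subsetneq V^1 \subsetneq \cdots \subsetneq V^n = V$ by subrepresentations whose successive quotients $S^i = V^i/V^{i-1}$ are $\alpha$-semistable with $\mu_\alpha(S^1) > \cdots > \mu_\alpha(S^n)$, and the Harder–Narasimhan type of $V$ along $\alpha$ is the tuple of dimension vectors $(\underline{\dim}_{S^1}, \ldots, \underline{\dim}_{S^n})$ (the empty tuple if $V = 0$). The central charge $\alpha$ is complete if any two finite-dimensional representations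 of $Q$ over $\mathbb{F}$ with the same Harder–Narasimhan type along $\alpha$ are isomorphic. Then $\alpha$ is complete if and only if $\alpha(x_i) > \alpha(x_{i+1})$ for all $i \in \{0,1,\ldots,\ell-1\}$. -/

import Mathlib

universe u v w

/-- A finite-dimensional representation over the field `K` of a quiver with vertex type `Q`: a
finite-dimensional vector space at each vertex and a linear map along each edge. The spaces live in
the universe of `K`, so that every dimension vector occurs. -/
structure QuiverRep (K : Type u) [Field K] (Q : Type v) [Quiver.{w} Q] where
  obj : Q → Type u
  [addCommGroup : ∀ x, AddCommGroup (obj x)]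
  [module : ∀ x, Module K (obj x)]
  [finiteDimensional : ∀ x, FiniteDimensional K (obj x)]
  map : ∀ {x y : Q}, (x ⟶ y) → obj x →ₗ[K] obj y

attribute [instance] QuiverRep.addCommGroup QuiverRep.module QuiverRep.finiteDimensional

namespace QuiverRep

variable {K : Type u} [Field K] {Q : Type v} [Quiver.{w} Q]

/-- An isomorphism of representations: linear isomorphisms at the vertices that commute with the
maps along the edges. -/
structure Iso (V W : QuiverRep K Q) where
  app : ∀ x, V.obj x ≃ₗ[K] W.obj x
  comm : ∀ {x y : Q} (e : x ⟶ y) (a : V.obj x), app y (V.map e a) = W.map e (app x a)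

/-- The dimension vector `x ↦ dim V_x`. -/
noncomputable def dimVec (V : QuiverRep K Q) : Q → ℕ :=
  fun x => Module.finrank K (V.obj x)

/-- `V` is nonzero: some vertex space is nontrivial. -/
def IsNonzero (V : QuiverRep K Q) : Prop :=
  ∃ x, Nontrivial (V.obj x)

/-- A subrepresentation of `V`: a family of subspaces preserved by the maps along the edges. -/
@[ext]
structure SubRep (V : QuiverRep K Q) where
  sub : ∀ x, Submodule K (V.obj x)
  le_comap : ∀ {x y : Q} (e : x ⟶ y), sub x ≤ (sub y).comap (V.map e)

namespace SubRep

variable {V : QuiverRep K Q}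

/-- Subrepresentations are ordered by vertexwise inclusion. -/
instance : PartialOrder (SubRep V) :=
  PartialOrder.lift SubRep.sub fun _ _ h => SubRep.ext h

/-- The zero subrepresentation. -/
instance : Bot (SubRep V) :=
  ⟨{ sub := fun _ => ⊥, le_comap := fun _ => bot_le }⟩

/-- The whole of `V`. -/
instance : Top (SubRep V) :=
  ⟨{ sub := fun _ => ⊤, le_comap := fun _ _ _ => Submodule.mem_top }⟩

/-- A subrepresentation regarded as a representation. -/
def toRep (U : SubRep V) : QuiverRep K Q where
  obj x := U.sub x
  map e := (V.map e).restrict (U.le_comap e)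

/-- The quotient representation `V / U`. -/
def quotient (U : SubRep V) : QuiverRep K Q where
  obj x := V.obj x ⧸ U.sub x
  map e := (U.sub _).mapQ (U.sub _) (V.map e) (U.le_comap e)

/-- `T ∩ U` as a subrepresentation of `U`; for `T ≤ U` this is `T` inside `U`. -/
def within (T U : SubRep V) : SubRep U.toRep where
  sub x := (T.sub x).submoduleOf (U.sub x)
  le_comap e := fun _ ha => T.le_comap e ha

/-- The subquotient `U / T` for `T ≤ U ⊆ V`. -/
def subquotient (T U : SubRep V) : QuiverRep K Q :=
  (T.within U).quotient

end SubRep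

variable [Fintype Q]

/-- The slope of `V` along the central charge `α` (meaningful for nonzero `V`). -/
noncomputable def slope (α : Q → ℝ) (V : QuiverRep K Q) : ℝ :=
  (∑ x, α x * (V.dimVec x : ℝ)) / ∑ x, (V.dimVec x : ℝ)

/-- `V` is `α`-semistable: it is nonzero, and no nonzero subrepresentation has larger slope. -/
def IsSemistable (α : Q → ℝ) (V : QuiverRep K Q) : Prop :=
  V.IsNonzero ∧ ∀ U : SubRep V, U.toRep.IsNonzero → slope α U.toRep ≤ slope α V

/-- A Harder-Narasimhan filtration `0 = V⁰ ⊊ V¹ ⊊ ⋯ ⊊ Vⁿ = V` along `α`: the successive quotients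
are semistable with strictly decreasing slopes. Length `n = 0` occurs exactly when `V = 0`. -/
structure HNFiltration (α : Q → ℝ) (V : QuiverRep K Q) where
  length : ℕ
  step : Fin (length + 1) → SubRep V
  step_zero : step 0 = ⊥
  step_last : step (Fin.last length) = ⊤
  step_lt : ∀ i : Fin length, step i.castSucc < step i.succ
  semistable : ∀ i : Fin length,
    IsSemistable α ((step i.castSucc).subquotient (step i.succ))
  slope_lt : ∀ i j : Fin length, i < j →
    slope α ((step j.castSucc).subquotient (step j.succ)) <
      slope α ((step i.castSucc).subquotient (step i.succ))

/-- The tuple of dimension vectors of the successive quotients of a filtration. -/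
noncomputable def HNFiltration.type {α : Q → ℝ} {V : QuiverRep K Q} (F : HNFiltration α V) :
    List (Q → ℕ) :=
  List.ofFn fun i : Fin F.length =>
    ((F.step i.castSucc).subquotient (F.step i.succ)).dimVec

open Classical in
/-- The Harder-Narasimhan type of `V` along `α`, read off from the Harder-Narasimhan filtration.
That filtration exists and is unique for every `V` (the empty filtration, with type `[]`, for
`V = 0`), so neither the choice nor the default value matters. -/
noncomputable def hnType (α : Q → ℝ) (V : QuiverRep K Q) : List (Q → ℕ) :=
  if h : Nonempty (HNFiltration α V) then h.some.type else []

variable (K) in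
/-- A collection `A` of central charges on the quiver `Q` is complete, on the category of all
finite-dimensional representations over `K`, if representations whose Harder-Narasimhan types agree
along all members of `A` are isomorphic. -/
def IsComplete (A : Set (Q → ℝ)) : Prop :=
  ∀ V W : QuiverRep K Q, (∀ α ∈ A, hnType α V = hnType α W) → Nonempty (Iso V W)

end QuiverRep

/-- The vertices `x_0, …, x_ℓ` of the equioriented quiver `x_0 → x_1 → ⋯ → x_ℓ` of type `𝔸_ℓ`; its
representations are the ordinary persistence modules. -/
def OrdinaryQuiver (ℓ : ℕ) : Type := Fin (ℓ + 1)

namespace OrdinaryQuiver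

/-- The vertex `x_i`. -/
abbrev x {ℓ : ℕ} (i : Fin (ℓ + 1)) : OrdinaryQuiver ℓ := i

instance (ℓ : ℕ) : Fintype (OrdinaryQuiver ℓ) := inferInstanceAs (Fintype (Fin (ℓ + 1)))

/-- The edges: exactly one edge `x_i → x_{i+1}` for each `0 ≤ i < ℓ`, and no others. -/
inductive Edge (ℓ : ℕ) : OrdinaryQuiver ℓ → OrdinaryQuiver ℓ → Type
  | edge (i : Fin ℓ) : Edge ℓ (x i.castSucc) (x i.succ)

instance (ℓ : ℕ) : Quiver (OrdinaryQuiver ℓ) := ⟨Edge ℓ⟩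

end OrdinaryQuiver

/-! Necessity: if `α` does not drop along `x_i → x_{i+1}`, compare the interval module on `{x_i,
x_{i+1}}` with the direct sum of the two simples. Both have a chain with quotients `S_{i+1}`, `S_i`
and weakly decreasing slopes, so their types agree, yet only one has a nonzero edge map.

Sufficiency: every persistence module is a sum of interval modules (`exists_barcode`). When `α`
strictly decreases, a subrepresentation of an interval module lives on a right end of the interval,
where `α` is smallest, so interval modules are semistable (`Barcode.wt_le_between`). Adding the bars
in order of decreasing slope gives a chain whose quotients of slope `μ` have total dimension vector
that of all bars of slope `μ`. These vectors determine the barcode: a bar of slope `μ(a,b)` that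
meets `a - 1` must also meet `a`, since otherwise its slope would be larger, and the slope of a bar
born at `a` determines its death. Hence the number of bars `[a,b]` is the difference of two
coordinates (`Barcode.card_eq_add`).

Both directions use chains with possibly repeated slopes rather than true Harder–Narasimhan
filtrations. The link is `WeakHN.jump_eq`: the part of slope `≥ μ` is the largest maximizer of `wt α
- μ * rk`, hence independent of the chain. -/

namespace QuiverRep

/-! ### Subrepresentations and their subquotients. -/

theorem finrank_comap_mkQ {K : Type*} [Field K] {E : Type*} [AddCommGroup E] [Module K E]
    [FiniteDimensional K E] (N : Submodule K E) (P : Submodule K (E ⧸ N)) :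
    Module.finrank K (P.comap N.mkQ) = Module.finrank K P + Module.finrank K N := by
  have h := LinearMap.finrank_range_add_finrank_ker (N.mkQ.domRestrict (P.comap N.mkQ))
  have hN : N ≤ P.comap N.mkQ := Submodule.le_comap_mkQ N P
  have h1 : LinearMap.range (N.mkQ.domRestrict (P.comap N.mkQ)) = P := by
    rw [LinearMap.range_domRestrict, Submodule.map_comap_eq_of_surjective N.mkQ_surjective]
  have h2 : LinearMap.ker (N.mkQ.domRestrict (P.comap N.mkQ)) =
      N.submoduleOf (P.comap N.mkQ) := by
    rw [LinearMap.ker_domRestrict, Submodule.ker_mkQ]; rfl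
  rw [h1, h2, (Submodule.submoduleOfEquivOfLe hN).finrank_eq] at h
  exact h.symm

variable {K : Type u} [Field K] {Q : Type v} [Quiver.{w} Q] {V : QuiverRep K Q}

namespace SubRep

/-- The dimension vector of a subrepresentation. -/
noncomputable def dim (X : SubRep V) (x : Q) : ℕ := Module.finrank K (X.sub x)

/-- The intersection of two subrepresentations. -/
def inter (X Y : SubRep V) : SubRep V where
  sub x := X.sub x ⊓ Y.sub x
  le_comap e := fun _ ha => ⟨X.le_comap e ha.1, Y.le_comap e ha.2⟩

/-- The sum of two subrepresentations. -/
def sum (X Y : SubRep V) : SubRep V where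
  sub x := X.sub x ⊔ Y.sub x
  le_comap e := sup_le
    ((X.le_comap e).trans (Submodule.comap_mono le_sup_left))
    ((Y.le_comap e).trans (Submodule.comap_mono le_sup_right))

theorem bot_le' (X : SubRep V) : ⊥ ≤ X := fun _ => bot_le

theorem le_top' (X : SubRep V) : X ≤ ⊤ := fun _ => le_top

theorem dim_mono {X Y : SubRep V} (h : X ≤ Y) (x : Q) : X.dim x ≤ Y.dim x :=
  Submodule.finrank_mono (h x)

theorem eq_of_le_of_dim_le {X Y : SubRep V} (h : X ≤ Y) (hd : ∀ x, Y.dim x ≤ X.dim x) : X = Y :=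
  SubRep.ext (funext fun x => Submodule.eq_of_le_of_finrank_le (h x) (hd x))

theorem dim_sum_add_dim_inter (X Y : SubRep V) (x : Q) :
    (X.sum Y).dim x + (X.inter Y).dim x = X.dim x + Y.dim x :=
  Submodule.finrank_sup_add_finrank_inf_eq _ _

theorem dim_bot (x : Q) : (⊥ : SubRep V).dim x = 0 := finrank_bot K (V.obj x)

theorem dimVec_subquotient {T U : SubRep V} (h : T ≤ U) (x : Q) :
    (T.subquotient U).dimVec x + T.dim x = U.dim x := by
  have := Submodule.finrank_quotient_add_finrank ((T.sub x).submoduleOf (U.sub x))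
  rw [(Submodule.submoduleOfEquivOfLe (h x)).finrank_eq] at this
  exact this

/-- With the lemma after it, this replaces subrepresentations of `U / T` by subrepresentations of
`V` between `T` and `U`. Only dimensions are recorded, since slopes see nothing else. -/
theorem exists_subRep_subquotient {T U X : SubRep V} (hT : T ≤ X) (hU : X ≤ U) :
    ∃ P : SubRep (T.subquotient U), ∀ x, P.toRep.dimVec x + T.dim x = X.dim x := by
  refine ⟨⟨fun x => ((X.sub x).submoduleOf (U.sub x)).map
    ((T.sub x).submoduleOf (U.sub x)).mkQ, ?_⟩, fun x => ?_⟩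
  · rintro x y e _ ⟨a, ha, rfl⟩
    exact ⟨⟨V.map e a, U.le_comap e a.2⟩, X.le_comap e ha, rfl⟩
  · have h := finrank_comap_mkQ ((T.sub x).submoduleOf (U.sub x))
      (((X.sub x).submoduleOf (U.sub x)).map ((T.sub x).submoduleOf (U.sub x)).mkQ)
    have hle : (T.sub x).submoduleOf (U.sub x) ≤ (X.sub x).submoduleOf (U.sub x) :=
      Submodule.comap_mono (hT x)
    rw [Submodule.comap_map_mkQ, sup_eq_right.2 hle,
      (Submodule.submoduleOfEquivOfLe (hT.trans hU x)).finrank_eq,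
      (Submodule.submoduleOfEquivOfLe (hU x)).finrank_eq] at h
    exact h.symm

theorem exists_between_of_subRep_subquotient {T U : SubRep V} (h : T ≤ U)
    (P : SubRep (T.subquotient U)) :
    ∃ X : SubRep V, T ≤ X ∧ X ≤ U ∧ ∀ x, P.toRep.dimVec x + T.dim x = X.dim x := by
  refine ⟨⟨fun x => ((P.sub x).comap ((T.sub x).submoduleOf (U.sub x)).mkQ).map (U.sub x).subtype,
    ?_⟩, ?_, ?_, fun x => ?_⟩
  · rintro x y e _ ⟨a, ha, rfl⟩
    exact ⟨⟨V.map e a, U.le_comap e a.2⟩, P.le_comap e ha, rfl⟩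
  · intro x a ha
    refine ⟨⟨a, h x ha⟩, ?_, rfl⟩
    exact Submodule.le_comap_mkQ ((T.sub x).submoduleOf (U.sub x)) (P.sub x) ha
  · rintro x _ ⟨a, ha, rfl⟩
    exact a.2
  · have h1 := finrank_comap_mkQ ((T.sub x).submoduleOf (U.sub x)) (P.sub x)
    rw [(Submodule.submoduleOfEquivOfLe (h x)).finrank_eq] at h1
    refine h1.symm.trans ?_
    exact (Submodule.finrank_map_subtype_eq _ _).symm

end SubRep

/-! ### Weights, and chains with weakly decreasing slopes. -/

variable [Fintype Q]

namespace SubRep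

/-- The sum of the dimensions of `X` weighted by `β`. -/
noncomputable def wt (β : Q → ℝ) (X : SubRep V) : ℝ := ∑ x, β x * (X.dim x : ℝ)

/-- The total dimension of `X`, as a real number. -/
noncomputable def rk (X : SubRep V) : ℝ := ∑ x, (X.dim x : ℝ)

theorem wt_sum_add_wt_inter (β : Q → ℝ) (X Y : SubRep V) :
    wt β (X.sum Y) + wt β (X.inter Y) = wt β X + wt β Y := by
  simp only [wt, ← Finset.sum_add_distrib, ← mul_add]
  refine Finset.sum_congr rfl fun x _ => ?_
  rw [← Nat.cast_add, ← Nat.cast_add, dim_sum_add_dim_inter]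

theorem rk_eq_wt (X : SubRep V) : X.rk = wt (fun _ => 1) X := by simp [rk, wt]

theorem rk_sum_add_rk_inter (X Y : SubRep V) :
    (X.sum Y).rk + (X.inter Y).rk = X.rk + Y.rk := by
  simp only [rk_eq_wt, wt_sum_add_wt_inter]

theorem rk_mono {X Y : SubRep V} (h : X ≤ Y) : X.rk ≤ Y.rk :=
  Finset.sum_le_sum fun x _ => Nat.cast_le.2 (dim_mono h x)

theorem eq_of_le_of_rk_le {X Y : SubRep V} (h : X ≤ Y) (hr : Y.rk ≤ X.rk) : X = Y := by
  refine eq_of_le_of_dim_le h fun x => ?_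
  have h1 : ∀ y ∈ Finset.univ, (X.dim y : ℝ) ≤ Y.dim y :=
    fun y _ => Nat.cast_le.2 (dim_mono h y)
  have h2 := (Finset.sum_eq_sum_iff_of_le h1).1 (le_antisymm (Finset.sum_le_sum h1) hr)
  exact (Nat.cast_injective (h2 x (Finset.mem_univ x))).ge

theorem rk_lt {X Y : SubRep V} (h : X < Y) : X.rk < Y.rk :=
  lt_of_not_ge fun hr => h.ne (eq_of_le_of_rk_le h.le hr)

end SubRep

open SubRep

/-- A chain of subrepresentations whose steps satisfy the semistability inequality, with weakly
decreasing slopes `slp t`. -/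
structure WeakHN (α : Q → ℝ) (V : QuiverRep K Q) where
  length : ℕ
  step : ℕ → SubRep V
  slp : ℕ → ℝ
  step_zero : step 0 = ⊥
  step_length : step length = ⊤
  step_le : ∀ t < length, step t ≤ step (t + 1)
  wt_eq : ∀ t < length, wt α (step (t + 1)) - wt α (step t) =
    slp t * ((step (t + 1)).rk - (step t).rk)
  wt_le : ∀ t < length, ∀ X, step t ≤ X → X ≤ step (t + 1) →
    wt α X - wt α (step t) ≤ slp t * (X.rk - (step t).rk)
  slp_anti : ∀ t u, t ≤ u → u < length → slp u ≤ slp t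

namespace WeakHN

variable {α : Q → ℝ}

theorem exists_cut (G : WeakHN α V) (μ : ℝ) : ∃ k ≤ G.length,
    (∀ t < k, μ ≤ G.slp t) ∧ ∀ t, k ≤ t → t < G.length → G.slp t < μ := by
  classical
  have hex : ∃ k, k = G.length ∨ G.slp k < μ := ⟨_, Or.inl rfl⟩
  have hle : Nat.find hex ≤ G.length := Nat.find_min' hex (Or.inl rfl)
  refine ⟨Nat.find hex, hle, fun t ht => ?_, fun t ht htl => ?_⟩
  · have := Nat.find_min hex ht
    push Not at this
    exact this.2
  · rcases Nat.find_spec hex with h | h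
    · omega
    · exact (G.slp_anti _ _ ht htl).trans_lt h

/-- Second isomorphism theorem: the step from `X ∩ Vᵗ` to `X ∩ Vᵗ⁺¹` has the dimensions of `Y / Vᵗ`
with `Y = (X ∩ Vᵗ⁺¹) + Vᵗ`, to which the semistability inequality of the chain applies. -/
theorem wt_inter_succ_sub (G : WeakHN α V) (X : SubRep V) (t : ℕ) (ht : t < G.length) (μ : ℝ) :
    ∃ Y, G.step t ≤ Y ∧ Y ≤ G.step (t + 1) ∧
      (X.inter (G.step (t + 1))).rk - (X.inter (G.step t)).rk = Y.rk - (G.step t).rk ∧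
      (wt α (X.inter (G.step (t + 1))) - μ * (X.inter (G.step (t + 1))).rk) -
      (wt α (X.inter (G.step t)) - μ * (X.inter (G.step t)).rk) ≤
        (G.slp t - μ) * (Y.rk - (G.step t).rk) := by
  have h0 := G.step_le t ht
  have hi : (X.inter (G.step (t + 1))).inter (G.step t) = X.inter (G.step t) := by
    ext x : 2
    change X.sub x ⊓ (G.step (t + 1)).sub x ⊓ (G.step t).sub x = X.sub x ⊓ (G.step t).sub x
    rw [inf_assoc, inf_eq_right.2 (h0 x)]
  have h1 : G.step t ≤ (X.inter (G.step (t + 1))).sum (G.step t) := fun x => le_sup_right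
  have h2 : (X.inter (G.step (t + 1))).sum (G.step t) ≤ G.step (t + 1) :=
    fun x => sup_le inf_le_right (h0 x)
  have h3 := G.wt_le t ht _ h1 h2
  have h4 := wt_sum_add_wt_inter α (X.inter (G.step (t + 1))) (G.step t)
  have h5 := rk_sum_add_rk_inter (X.inter (G.step (t + 1))) (G.step t)
  rw [hi] at h4 h5
  refine ⟨_, h1, h2, by linarith, ?_⟩
  generalize (X.inter (G.step (t + 1))).sum (G.step t) = Y at *
  have h6 : (X.inter (G.step (t + 1))).rk - (X.inter (G.step t)).rk = Y.rk - (G.step t).rk := by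
    linarith
  have h7 : μ * (X.inter (G.step (t + 1))).rk - μ * (X.inter (G.step t)).rk =
    μ * (Y.rk - (G.step t).rk) := by rw [← h6]; ring
  linarith

theorem wt_inter_le (G : WeakHN α V) (X : SubRep V) (μ : ℝ) (k : ℕ) (hk : k ≤ G.length)
    (h : ∀ t < k, μ ≤ G.slp t) :
    wt α (X.inter (G.step k)) - μ * (X.inter (G.step k)).rk ≤
      wt α (G.step k) - μ * (G.step k).rk := by
  induction k with
  | zero =>
    have : X.inter (G.step 0) = G.step 0 := by
      rw [G.step_zero]; ext x : 2; exact inf_bot_eq _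
    rw [this]
  | succ k ih =>
    have ih := ih (by omega) fun t ht => h t (by omega)
    obtain ⟨Y, -, hY, -, h1⟩ := G.wt_inter_succ_sub X k (by omega) μ
    have h2 := G.wt_eq k (by omega)
    have h3 : (G.slp k - μ) * (Y.rk - (G.step k).rk) ≤
        (G.slp k - μ) * ((G.step (k + 1)).rk - (G.step k).rk) :=
      mul_le_mul_of_nonneg_left (sub_le_sub_right (rk_mono hY) _)
        (sub_nonneg.2 (h k (by omega)))
    linarith

/-- Past the cut each step has slope below `μ`, so enlarging `X ∩ Vᵏ` can only lower `wt α - μ *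
rk`, and strictly so unless the rank stays the same. The equality clause makes the maximizer at the
cut the largest one. -/
theorem wt_inter_le_of_lt (G : WeakHN α V) (X : SubRep V) (μ : ℝ) (k l : ℕ) (hkl : k ≤ l)
    (hl : l ≤ G.length) (h : ∀ t, k ≤ t → t < G.length → G.slp t < μ) :
    wt α (X.inter (G.step l)) - μ * (X.inter (G.step l)).rk ≤
      wt α (X.inter (G.step k)) - μ * (X.inter (G.step k)).rk ∧
    (wt α (X.inter (G.step l)) - μ * (X.inter (G.step l)).rk =
      wt α (X.inter (G.step k)) - μ * (X.inter (G.step k)).rk →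
      (X.inter (G.step l)).rk = (X.inter (G.step k)).rk) := by
  induction l, hkl using Nat.le_induction with
  | base => exact ⟨le_rfl, fun _ => rfl⟩
  | succ l hkl ih =>
    obtain ⟨ih1, ih2⟩ := ih (by omega)
    obtain ⟨Y, hY, -, h0, h1⟩ := G.wt_inter_succ_sub X l (by omega) μ
    have hs := h l hkl (by omega)
    have hr := rk_mono hY
    have h3 : (G.slp l - μ) * (Y.rk - (G.step l).rk) ≤ 0 :=
      mul_nonpos_of_nonpos_of_nonneg (by linarith) (by linarith)
    refine ⟨by linarith, fun he => ?_⟩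
    have h4 : (G.slp l - μ) * (Y.rk - (G.step l).rk) = 0 := by linarith
    rcases mul_eq_zero.1 h4 with h5 | h5
    · linarith
    · have := ih2 (by linarith)
      linarith

/-- The part of a chain with slopes `≥ μ` is the largest maximizer of `wt α - μ * rk`. -/
theorem wt_le_of_cut (G : WeakHN α V) (X : SubRep V) (μ : ℝ) (k : ℕ) (hk : k ≤ G.length)
    (h1 : ∀ t < k, μ ≤ G.slp t) (h2 : ∀ t, k ≤ t → t < G.length → G.slp t < μ) :
    wt α X - μ * X.rk ≤ wt α (G.step k) - μ * (G.step k).rk ∧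
    (wt α X - μ * X.rk = wt α (G.step k) - μ * (G.step k).rk → X ≤ G.step k) := by
  have hX : X.inter (G.step G.length) = X := by
    rw [G.step_length]; ext x : 2; exact inf_top_eq _
  have h3 := G.wt_inter_le X μ k hk h1
  obtain ⟨h4, h5⟩ := G.wt_inter_le_of_lt X μ k G.length hk le_rfl h2
  rw [hX] at h4 h5
  refine ⟨by linarith, fun he => ?_⟩
  have h6 := h5 (by linarith)
  have h7 : X.inter (G.step k) = X := eq_of_le_of_rk_le (fun x => inf_le_left) h6.le
  rw [← h7]
  exact fun x => inf_le_right

/-- The dimension vector contributed by the steps of slope `μ`. -/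
noncomputable def jump (G : WeakHN α V) (μ : ℝ) (x : Q) : ℝ :=
  ∑ t ∈ Finset.range G.length with G.slp t = μ, (((G.step (t + 1)).dim x : ℝ) - (G.step t).dim x)

theorem sum_filter_eq (G H : WeakHN α V) (μ : ℝ) (x : Q) :
    ∑ t ∈ Finset.range G.length with μ ≤ G.slp t,
      (((G.step (t + 1)).dim x : ℝ) - (G.step t).dim x) =
    ∑ t ∈ Finset.range H.length with μ ≤ H.slp t,
      (((H.step (t + 1)).dim x : ℝ) - (H.step t).dim x) := by
  have key : ∀ (G : WeakHN α V) (k : ℕ), k ≤ G.length → (∀ t < k, μ ≤ G.slp t) →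
      (∀ t, k ≤ t → t < G.length → G.slp t < μ) →
      ∑ t ∈ Finset.range G.length with μ ≤ G.slp t,
        (((G.step (t + 1)).dim x : ℝ) - (G.step t).dim x) = (G.step k).dim x := by
    intro G k hk h1 h2
    have : (Finset.range G.length).filter (fun t => μ ≤ G.slp t) = Finset.range k := by
      ext t
      simp only [Finset.mem_filter, Finset.mem_range]
      refine ⟨fun ⟨h, h'⟩ => ?_, fun h => ⟨by omega, h1 t h⟩⟩
      by_contra hc
      exact absurd (h2 t (by omega) h) (not_lt.2 h')
    rw [this, Finset.sum_range_sub (fun t => ((G.step t).dim x : ℝ)), G.step_zero, dim_bot]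
    simp
  obtain ⟨k, hk, hk1, hk2⟩ := G.exists_cut μ
  obtain ⟨l, hl, hl1, hl2⟩ := H.exists_cut μ
  rw [key G k hk hk1 hk2, key H l hl hl1 hl2]
  have a1 := G.wt_le_of_cut (H.step l) μ k hk hk1 hk2
  have a2 := H.wt_le_of_cut (G.step k) μ l hl hl1 hl2
  -- Each cut is a maximizer, so each is contained in the other.
  rw [le_antisymm (a2.2 (le_antisymm a2.1 a1.1)) (a1.2 (le_antisymm a1.1 a2.1))]

theorem jump_eq (G H : WeakHN α V) (μ : ℝ) (x : Q) : G.jump μ x = H.jump μ x := by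
  have hfin : ∀ G : WeakHN α V, ∀ᶠ ν in nhdsWithin μ (Set.Ioi μ),
      ∀ t ∈ Finset.range G.length, μ < G.slp t → ν ≤ G.slp t := by
    intro G
    rw [Filter.eventually_all_finset]
    intro t _
    by_cases h : μ < G.slp t
    · filter_upwards [Ioo_mem_nhdsGT h] with ν hν _ using hν.2.le
    · exact Filter.Eventually.of_forall fun ν h' => absurd h' h
  -- `ν` lies above `μ` but not above any larger slope of either chain, so slopes `≥ μ` split into
  -- those equal to `μ` and those `≥ ν`.
  obtain ⟨ν, ⟨hG, hH⟩, hν⟩ := (((hfin G).and (hfin H)).and self_mem_nhdsWithin).exists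
  have hν : μ < ν := hν
  have key : ∀ G : WeakHN α V, (∀ t ∈ Finset.range G.length, μ < G.slp t → ν ≤ G.slp t) →
      G.jump μ x + ∑ t ∈ Finset.range G.length with ν ≤ G.slp t,
        (((G.step (t + 1)).dim x : ℝ) - (G.step t).dim x) =
      ∑ t ∈ Finset.range G.length with μ ≤ G.slp t,
        (((G.step (t + 1)).dim x : ℝ) - (G.step t).dim x) := by
    intro G hG
    rw [jump, ← Finset.sum_union]
    · refine Finset.sum_congr ?_ fun _ _ => rfl
      ext t
      simp only [Finset.mem_union, Finset.mem_filter]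
      constructor
      · rintro (⟨h, rfl⟩ | ⟨h, h'⟩)
        · exact ⟨h, le_rfl⟩
        · exact ⟨h, hν.le.trans h'⟩
      · rintro ⟨h, h'⟩
        rcases h'.eq_or_lt with h'' | h''
        · exact Or.inl ⟨h, h''.symm⟩
        · exact Or.inr ⟨h, hG t h h''⟩
    · rw [Finset.disjoint_filter]
      rintro t _ rfl
      exact not_le.2 hν
  have h1 := key G hG
  have h2 := key H hH
  rw [sum_filter_eq G H, sum_filter_eq G H] at h1
  linarith

end WeakHN

end QuiverRep

/-! ### Existence of Harder–Narasimhan filtrations, and reading off the type. -/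

namespace QuiverRep

open SubRep

/-- The slope of a dimension vector. -/
noncomputable def dimSlope {Q : Type*} [Fintype Q] (α : Q → ℝ) (v : Q → ℕ) : ℝ :=
  (∑ x, α x * (v x : ℝ)) / ∑ x, (v x : ℝ)

theorem sum_pos_of_ne_zero {Q : Type*} [Fintype Q] {v : Q → ℕ} (h : v ≠ 0) : 0 < ∑ x, (v x : ℝ) := by
  obtain ⟨x, hx⟩ := Function.ne_iff.1 h
  exact Finset.sum_pos' (fun _ _ => Nat.cast_nonneg _)
    ⟨x, Finset.mem_univ x, Nat.cast_pos.2 (Nat.pos_of_ne_zero hx)⟩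

variable {K : Type u} [Field K] {Q : Type v} [Quiver.{w} Q] {V W : QuiverRep K Q}

theorem isNonzero_iff : V.IsNonzero ↔ V.dimVec ≠ 0 := by
  constructor
  · rintro ⟨x, hx⟩ h
    exact (Module.finrank_pos_iff.2 hx).ne' (congrFun h x)
  · intro h
    obtain ⟨x, hx⟩ := Function.ne_iff.1 h
    exact ⟨x, Module.finrank_pos_iff.1 (Nat.pos_of_ne_zero hx)⟩

variable [Fintype Q] {α : Q → ℝ}

theorem sum_mul_eq_wt_sub {T X : SubRep V} {v : Q → ℕ} (h : ∀ x, v x + T.dim x = X.dim x)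
    (β : Q → ℝ) : ∑ x, β x * (v x : ℝ) = wt β X - wt β T := by
  rw [wt, wt, ← Finset.sum_sub_distrib]
  refine Finset.sum_congr rfl fun x _ => ?_
  rw [← h x]; push_cast; ring

theorem sum_eq_rk_sub {T X : SubRep V} {v : Q → ℕ} (h : ∀ x, v x + T.dim x = X.dim x) :
    ∑ x, (v x : ℝ) = X.rk - T.rk := by
  have := sum_mul_eq_wt_sub h (fun _ => 1)
  simpa only [one_mul, rk_eq_wt] using this

theorem slope_subquotient {T U : SubRep V} (h : T ≤ U) :
    slope α (T.subquotient U) = (wt α U - wt α T) / (U.rk - T.rk) := by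
  rw [slope, sum_mul_eq_wt_sub (dimVec_subquotient h), sum_eq_rk_sub (dimVec_subquotient h)]

theorem isNonzero_subquotient {T U : SubRep V} (h : T < U) : (T.subquotient U).IsNonzero := by
  rw [isNonzero_iff]
  intro h0
  have := sum_eq_rk_sub (dimVec_subquotient h.le)
  rw [h0] at this
  have := rk_lt h
  simp at *
  linarith

theorem IsSemistable.wt_le {T U X : SubRep V} (hs : IsSemistable α (T.subquotient U))
    (h1 : T ≤ X) (h2 : X ≤ U) :
    wt α X - wt α T ≤ slope α (T.subquotient U) * (X.rk - T.rk) := by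
  obtain ⟨P, hP⟩ := exists_subRep_subquotient h1 h2
  rw [← sum_mul_eq_wt_sub hP α, ← sum_eq_rk_sub hP]
  by_cases h0 : P.toRep.dimVec = 0
  · simp [h0]
  · exact (div_le_iff₀ (sum_pos_of_ne_zero h0)).1 (hs.2 P (isNonzero_iff.2 h0))

theorem isSemistable_subquotient {T U : SubRep V} (hT : T < U)
    (h : ∀ X, T < X → X ≤ U →
      (wt α X - wt α T) / (X.rk - T.rk) ≤ (wt α U - wt α T) / (U.rk - T.rk)) :
    IsSemistable α (T.subquotient U) := by
  refine ⟨isNonzero_subquotient hT, fun P hP => ?_⟩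
  obtain ⟨X, h1, h2, hX⟩ := exists_between_of_subRep_subquotient hT.le P
  have h3 : T < X := by
    refine lt_of_le_of_ne h1 ?_
    rintro rfl
    exact isNonzero_iff.1 hP (funext fun x => by simpa using hX x)
  rw [slope_subquotient hT.le, slope, sum_mul_eq_wt_sub hX α, sum_eq_rk_sub hX]
  exact h X h3 h2

theorem exists_maximal_destabilizing (α : Q → ℝ) {T : SubRep V} (hT : T < ⊤) :
    ∃ X, T < X ∧ IsSemistable α (T.subquotient X) ∧
      ∀ Y, X < Y → slope α (X.subquotient Y) < slope α (T.subquotient X) := by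
  classical
  have hfin : (SubRep.dim '' {X : SubRep V | T < X}).Finite := by
    refine (Set.finite_Iic ((⊤ : SubRep V).dim)).subset ?_
    rintro _ ⟨X, -, rfl⟩ x
    exact dim_mono X.le_top' x
  -- Maximize lexicographically the slope of `X / T`, then the rank of `X`. Maximal slope gives
  -- semistability; maximal rank makes every `Y / X` of strictly smaller slope. The maximum is taken
  -- over dimension vectors, of which there are finitely many even when there are infinitely many
  -- subrepresentations.
  obtain ⟨v, ⟨X, hX, rfl⟩, hmax⟩ := Set.exists_max_image _
    (fun v : Q → ℕ => toLex ((∑ x, α x * (v x : ℝ) - wt α T) / (∑ x, (v x : ℝ) - T.rk),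
      ∑ x, (v x : ℝ))) hfin ⟨_, ⊤, hT, rfl⟩
  have hX : T < X := hX
  have hmax : ∀ Y, T < Y → (wt α Y - wt α T) / (Y.rk - T.rk) < (wt α X - wt α T) / (X.rk - T.rk) ∨
      ((wt α Y - wt α T) / (Y.rk - T.rk) = (wt α X - wt α T) / (X.rk - T.rk) ∧ Y.rk ≤ X.rk) :=
    fun Y hY => Prod.Lex.le_iff.1 (hmax _ ⟨Y, hY, rfl⟩)
  refine ⟨X, hX, isSemistable_subquotient hX fun Y hY _ => ?_, fun Y hY => ?_⟩
  · rcases hmax Y hY with h | h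
    exacts [h.le, h.1.le]
  · rw [slope_subquotient hX.le, slope_subquotient hY.le]
    have r1 := rk_lt hX
    have r2 := rk_lt hY
    rcases hmax Y (hX.trans hY) with h | h
    · rw [div_lt_iff₀ (by linarith)] at h ⊢
      have h1 : wt α X - wt α T =
        (wt α X - wt α T) / (X.rk - T.rk) * (X.rk - T.rk) := by
        rw [div_mul_cancel₀]; linarith
      generalize (wt α X - wt α T) / (X.rk - T.rk) = s at *
      nlinarith
    · linarith [h.2]

theorem exists_chain (α : Q → ℝ) (V : QuiverRep K Q) (T : SubRep V) :
    ∃ (n : ℕ) (step : ℕ → SubRep V), step 0 = T ∧ step n = ⊤ ∧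
      (∀ t < n, step t < step (t + 1) ∧ IsSemistable α ((step t).subquotient (step (t + 1)))) ∧
      ∀ t, t + 1 < n → slope α ((step (t + 1)).subquotient (step (t + 2))) <
        slope α ((step t).subquotient (step (t + 1))) := by
  have hwf : WellFounded (fun X Y : SubRep V => Y < X) := by
    refine Subrelation.wf (r := InvImage (· < ·)
      (fun X : SubRep V => ∑ x, ((⊤ : SubRep V).dim x - X.dim x))) ?_ (InvImage.wf _ wellFounded_lt)
    intro X Y h
    refine Finset.sum_lt_sum (fun x _ => Nat.sub_le_sub_left (dim_mono h.le x) _) ?_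
    by_contra! hc
    refine h.ne (eq_of_le_of_dim_le h.le fun x => ?_)
    have h1 := hc x (Finset.mem_univ x)
    have h2 := dim_mono X.le_top' x
    omega
  induction T using hwf.induction with
  | _ T ih =>
    by_cases hT : T = ⊤
    · exact ⟨0, fun _ => T, rfl, hT, by simp, by simp⟩
    obtain ⟨X, h1, h2, h3⟩ := exists_maximal_destabilizing α (lt_of_le_of_ne T.le_top' hT)
    obtain ⟨n, step, e0, e1, e2, e3⟩ := ih X h1
    refine ⟨n + 1, fun t => Nat.casesOn t T step, rfl, e1, ?_, ?_⟩
    · rintro (_ | t) ht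
      · simp only [e0]; exact ⟨h1, h2⟩
      · exact e2 t (by omega)
    · rintro (_ | t) ht
      · have := e2 0 (by omega)
        simp only [e0] at this ⊢
        exact h3 _ this.1
      · exact e3 t (by omega)

theorem nonempty_hnFiltration (α : Q → ℝ) (V : QuiverRep K Q) : Nonempty (HNFiltration α V) := by
  obtain ⟨n, step, e0, e1, e2, e3⟩ := exists_chain α V ⊥
  refine ⟨⟨n, fun i => step i, e0, e1, fun i => (e2 i i.2).1, fun i => (e2 i i.2).2, ?_⟩⟩
  rintro ⟨i, hi⟩ ⟨j, hj⟩ hij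
  have hij : i < j := hij
  change slope α ((step j).subquotient (step (j + 1))) < slope α ((step i).subquotient (step (i + 1)))
  clear * - e3 hij hj
  induction j, hij using Nat.le_induction with
  | base => exact e3 i hj
  | succ j hij ih => exact (e3 j hj).trans (ih (by omega))

namespace HNFiltration

/-- A Harder-Narasimhan filtration as a chain indexed by `ℕ`. -/
noncomputable def toWeakHN (F : HNFiltration α V) : WeakHN α V where
  length := F.length
  -- The clamped index and the slope `0` past the end are harmless: nothing is required of a
  -- `WeakHN` beyond `length`.
  step t := F.step ⟨min t F.length, by omega⟩
  slp t := if h : t < F.length then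
    slope α ((F.step (Fin.castSucc ⟨t, h⟩)).subquotient (F.step (Fin.succ ⟨t, h⟩))) else 0
  step_zero := by simpa using F.step_zero
  step_length := by simp only [min_self]; exact F.step_last
  step_le t ht := by
    have := (F.step_lt ⟨t, ht⟩).le
    simpa [Nat.min_eq_left ht.le, Nat.min_eq_left (Nat.succ_le_of_lt ht)] using this
  wt_eq t ht := by
    have h := F.step_lt ⟨t, ht⟩
    have := rk_lt h
    simp only [ht, dif_pos, Nat.min_eq_left ht.le, Nat.min_eq_left (Nat.succ_le_of_lt ht)]
    rw [slope_subquotient h.le]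
    exact (div_mul_cancel₀ _ (by linarith)).symm
  wt_le t ht X h1 h2 := by
    simp only [ht, dif_pos, Nat.min_eq_left ht.le, Nat.min_eq_left (Nat.succ_le_of_lt ht)] at h1 h2 ⊢
    exact (F.semistable ⟨t, ht⟩).wt_le h1 h2
  slp_anti t u htu hu := by
    rcases htu.eq_or_lt with rfl | h
    · exact le_rfl
    · simp only [hu, htu.trans_lt hu, dif_pos]
      exact (F.slope_lt ⟨t, _⟩ ⟨u, _⟩ h).le

theorem jump_slope (F : HNFiltration α V) (i : Fin F.length) (x : Q) :
    F.toWeakHN.jump (slope α ((F.step i.castSucc).subquotient (F.step i.succ))) x =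
      ((F.step i.castSucc).subquotient (F.step i.succ)).dimVec x := by
  have hf : (Finset.range F.toWeakHN.length).filter (fun t => F.toWeakHN.slp t =
      slope α ((F.step i.castSucc).subquotient (F.step i.succ))) = {i.1} := by
    ext t
    rw [Finset.mem_filter, Finset.mem_range, Finset.mem_singleton]
    change (t < F.length ∧ dite _ _ _ = _) ↔ _
    constructor
    · rintro ⟨ht, h⟩
      rw [dif_pos ht] at h
      rcases lt_trichotomy t i.1 with h' | h' | h'
      · exact absurd h (F.slope_lt ⟨t, ht⟩ i h').ne'
      · exact h'
      · exact absurd h (F.slope_lt i ⟨t, ht⟩ h').ne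
    · rintro rfl
      exact ⟨i.2, by rw [dif_pos i.2]⟩
  rw [WeakHN.jump, hf, Finset.sum_singleton]
  have h := dimVec_subquotient (F.step_lt i).le x
  have hi := i.2
  simp only [toWeakHN, Nat.min_eq_left hi.le, Nat.min_eq_left (Nat.succ_le_of_lt hi)]
  have h' : (((F.step i.castSucc).subquotient (F.step i.succ)).dimVec x : ℝ) +
    (F.step i.castSucc).dim x = (F.step i.succ).dim x := by exact_mod_cast h
  rw [← sub_eq_iff_eq_add.2 h'.symm]
  rfl

/-- Slopes in the filtration are distinct, so each quotient is the whole jump at its own slope. This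
describes the type by data independent of the chosen filtration. -/
theorem mem_type_iff (F : HNFiltration α V) (v : Q → ℕ) :
    v ∈ F.type ↔ v ≠ 0 ∧ ∀ x, (v x : ℝ) = F.toWeakHN.jump (dimSlope α v) x := by
  rw [type, List.mem_ofFn]
  constructor
  · rintro ⟨i, rfl⟩
    exact ⟨isNonzero_iff.1 (F.semistable i).1, fun x => (F.jump_slope i x).symm⟩
  · rintro ⟨h0, h⟩
    obtain ⟨x, hx⟩ := Function.ne_iff.1 h0
    have h1 : F.toWeakHN.jump (dimSlope α v) x ≠ 0 := by
      rw [← h x]; exact Nat.cast_ne_zero.2 hx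
    obtain ⟨t, ht, -⟩ := Finset.exists_ne_zero_of_sum_ne_zero h1
    obtain ⟨ht, hs⟩ := Finset.mem_filter.1 ht
    have ht : t < F.length := Finset.mem_range.1 ht
    have hs' : F.toWeakHN.slp t = slope α ((F.step (Fin.castSucc ⟨t, ht⟩)).subquotient
      (F.step (Fin.succ ⟨t, ht⟩))) := dif_pos ht
    refine ⟨⟨t, ht⟩, funext fun y => ?_⟩
    have := h y
    rw [← hs, hs', F.jump_slope] at this
    exact_mod_cast this.symm

theorem pairwise_type (F : HNFiltration α V) :
    F.type.Pairwise fun v w => dimSlope α w < dimSlope α v := by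
  rw [type, List.pairwise_ofFn]
  exact fun i j h => F.slope_lt i j h

end HNFiltration

theorem exists_hnType (α : Q → ℝ) (V : QuiverRep K Q) :
    ∃ F : HNFiltration α V, hnType α V = F.type :=
  ⟨(nonempty_hnFiltration α V).some, dif_pos _⟩

/-- Membership in the Harder-Narasimhan type, read off from any chain with weakly decreasing
slopes. -/
theorem WeakHN.mem_hnType_iff (G : WeakHN α V) (v : Q → ℕ) :
    v ∈ hnType α V ↔ v ≠ 0 ∧ ∀ x, (v x : ℝ) = G.jump (dimSlope α v) x := by
  obtain ⟨F, hF⟩ := exists_hnType α V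
  simp only [hF, F.mem_type_iff, F.toWeakHN.jump_eq G]

/-- The jumps fix the members of the type, and strictly decreasing slopes fix their order. -/
theorem hnType_eq_of_jump_eq (G : WeakHN α V) (H : WeakHN α W)
    (h : ∀ μ x, G.jump μ x = H.jump μ x) : hnType α V = hnType α W := by
  have hmem : ∀ v, v ∈ hnType α V ↔ v ∈ hnType α W := fun v => by
    simp only [G.mem_hnType_iff, H.mem_hnType_iff, h]
  obtain ⟨F, hF⟩ := exists_hnType α V
  obtain ⟨F', hF'⟩ := exists_hnType α W
  simp only [hF, hF'] at hmem ⊢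
  have hn : ∀ {l : List (Q → ℕ)}, l.Pairwise (fun v w => dimSlope α w < dimSlope α v) → l.Nodup :=
    fun hl => hl.imp fun h => by rintro rfl; exact lt_irrefl _ h
  exact ((List.perm_ext_iff_of_nodup (hn F.pairwise_type) (hn F'.pairwise_type)).2
    hmem).eq_of_pairwise (fun a b _ _ h1 h2 => absurd h1 h2.not_gt) F.pairwise_type F'.pairwise_type

end QuiverRep

/-! ### Necessity: two modules that are not separated when `α` fails to drop. -/

namespace QuiverRep

open SubRep

section SimpleStep

variable {K : Type u} [Field K] {Q : Type v} [Quiver.{w} Q] [Fintype Q] {V : QuiverRep K Q}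

/-- A quotient `U / T` concentrated at one vertex `q` has all its subrepresentations of slope `α q`,
so it satisfies the semistability inequality with equality. -/
theorem SubRep.wt_sub_eq_of_dim_eq (α : Q → ℝ) {T U X : SubRep V} (q : Q)
    (h : ∀ x, x ≠ q → U.dim x = T.dim x) (h1 : T ≤ X) (h2 : X ≤ U) :
    wt α X - wt α T = α q * (X.rk - T.rk) := by
  rw [wt, wt, rk, rk, ← Finset.sum_sub_distrib, ← Finset.sum_sub_distrib, Finset.mul_sum]
  refine Finset.sum_congr rfl fun x _ => ?_
  by_cases hx : x = q
  · rw [hx]; ring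
  · have h3 := dim_mono h1 x
    have h4 := dim_mono h2 x
    have : X.dim x = T.dim x := by have := h x hx; omega
    rw [this]; ring

end SimpleStep

variable {K : Type u} [Field K] {ℓ : ℕ}

open Classical in
/-- The representation with a line at `x_i` and at `x_{i+1}`, and multiplication by `c` between
them. -/
noncomputable def twoStep (i : Fin ℓ) (c : K) : QuiverRep K (OrdinaryQuiver ℓ) where
  obj x := PLift (x = OrdinaryQuiver.x i.castSucc ∨ x = OrdinaryQuiver.x i.succ) → K
  map {x y} _ :=
    { toFun := fun g _ => c *
        if h : x = OrdinaryQuiver.x i.castSucc ∨ x = OrdinaryQuiver.x i.succ then g ⟨h⟩ else 0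
      map_add' := fun g g' => by
        funext z
        by_cases h : x = OrdinaryQuiver.x i.castSucc ∨ x = OrdinaryQuiver.x i.succ <;>
          simp [h, mul_add]
      map_smul' := fun a g => by
        funext z
        by_cases h : x = OrdinaryQuiver.x i.castSucc ∨ x = OrdinaryQuiver.x i.succ <;>
          simp [h, mul_left_comm] }

open Classical in
/-- The line at `x_{i+1}` inside `twoStep i c`. -/
noncomputable def twoStepSub (i : Fin ℓ) (c : K) : SubRep (twoStep i c) where
  sub x := if x = OrdinaryQuiver.x i.succ then ⊤ else ⊥
  le_comap {x y} e := by
    intro a ha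
    rcases e with ⟨j⟩
    by_cases hj : j.succ = i.succ
    · have : OrdinaryQuiver.x j.succ = OrdinaryQuiver.x i.succ := hj
      simp [this]
    · by_cases hj' : j.castSucc = i.succ
      · have h1 : ¬ (OrdinaryQuiver.x j.succ = OrdinaryQuiver.x i.castSucc ∨
            OrdinaryQuiver.x j.succ = OrdinaryQuiver.x i.succ) := by
          rintro (h | h)
          · have h : j.succ = i.castSucc := h
            simp only [Fin.ext_iff, Fin.val_succ, Fin.val_castSucc] at h hj'
            omega
          · exact hj h
        have h2 : (twoStep i c).map (OrdinaryQuiver.Edge.edge j) a = 0 :=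
          funext fun z => absurd z.down h1
        rw [Submodule.mem_comap, h2]
        exact Submodule.zero_mem _
      · have h1 : ¬ OrdinaryQuiver.x j.castSucc = OrdinaryQuiver.x i.succ := hj'
        rw [if_neg h1, Submodule.mem_bot] at ha
        rw [ha]
        exact Submodule.zero_mem _

/-- The steps `0`, `S_{i+1}`, `twoStep i c`. -/
noncomputable def twoStepChain (i : Fin ℓ) (c : K) : ℕ → SubRep (twoStep i c)
  | 0 => ⊥
  | 1 => twoStepSub i c
  | _ => ⊤

/-- The chain `0 ⊂ S_{i+1} ⊂ twoStep i c`. -/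
noncomputable def twoStepWeakHN (i : Fin ℓ) (c : K) {α : OrdinaryQuiver ℓ → ℝ}
    (h : α (OrdinaryQuiver.x i.castSucc) ≤ α (OrdinaryQuiver.x i.succ)) :
    WeakHN α (twoStep i c) := by
  have key : ∀ t < 2, ∀ X : SubRep (twoStep i c),
      (twoStepChain i c t) ≤ X →
      X ≤ (twoStepChain i c (t + 1)) →
      wt α X - wt α (twoStepChain i c t) =
      (if t = 0 then α (OrdinaryQuiver.x i.succ) else α (OrdinaryQuiver.x i.castSucc)) *
        (X.rk - (twoStepChain i c t).rk) := by
    intro t ht X h1 h2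
    interval_cases t
    · refine wt_sub_eq_of_dim_eq α _ (fun x hx => ?_) h1 h2
      exact congrArg (fun S : Submodule K ((twoStep i c).obj x) => Module.finrank K S) (if_neg hx)
    · refine wt_sub_eq_of_dim_eq α _ (fun x hx => ?_) h1 h2
      by_cases hx' : x = OrdinaryQuiver.x i.succ
      · exact congrArg (fun S : Submodule K ((twoStep i c).obj x) => Module.finrank K S)
          (if_pos hx').symm
      · have h3 : ∀ a : (twoStep i c).obj x, a = 0 :=
          fun a => funext fun z => absurd z.down (not_or.2 ⟨hx, hx'⟩)
        have : Subsingleton ((twoStep i c).obj x) := ⟨fun a b => (h3 a).trans (h3 b).symm⟩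
        simp only [dim]
        rw [Module.finrank_zero_of_subsingleton, Module.finrank_zero_of_subsingleton]
  have hle : ∀ t < 2,
      (twoStepChain i c t) ≤
      (twoStepChain i c (t + 1)) := by
    intro t ht
    interval_cases t
    · exact bot_le' _
    · exact le_top' _
  exact
  { length := 2
    step := twoStepChain i c
    slp := fun t => if t = 0 then α (OrdinaryQuiver.x i.succ) else α (OrdinaryQuiver.x i.castSucc)
    step_zero := rfl
    step_length := rfl
    step_le := hle
    wt_eq := fun t ht => key t ht _ (hle t ht) le_rfl
    wt_le := fun t ht X h1 h2 => (key t ht X h1 h2).le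
    slp_anti := fun t u htu hu => by
      have : t < 2 := by omega
      interval_cases u <;> interval_cases t <;> simp_all }

/-- Neither the spaces nor the chain depends on the scalar, so the jumps agree by definition. -/
theorem hnType_twoStep_eq (i : Fin ℓ) (c d : K) {α : OrdinaryQuiver ℓ → ℝ}
    (h : α (OrdinaryQuiver.x i.castSucc) ≤ α (OrdinaryQuiver.x i.succ)) :
    hnType α (twoStep i c) = hnType α (twoStep i d) := by
  refine hnType_eq_of_jump_eq (twoStepWeakHN i c h) (twoStepWeakHN i d h) fun μ x => ?_
  refine Finset.sum_congr rfl fun t ht => ?_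
  have ht : t < 2 := Finset.mem_range.1 (Finset.mem_filter.1 ht).1
  interval_cases t <;> rfl

open Classical in
theorem not_nonempty_iso_twoStep (i : Fin ℓ) :
    ¬ Nonempty (Iso (twoStep i (1 : K)) (twoStep i (0 : K))) := by
  rintro ⟨φ⟩
  have h1 := φ.comm (OrdinaryQuiver.Edge.edge i) (fun _ => (1 : K))
  have h2 : ∀ a, (twoStep i (0 : K)).map (OrdinaryQuiver.Edge.edge i) a = 0 :=
    fun a => funext fun z => zero_mul _
  rw [h2, LinearEquiv.map_eq_zero_iff] at h1
  have h3 := congrFun h1 ⟨Or.inr rfl⟩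
  change (1 : K) * (if h : _ then (1 : K) else 0) = 0 at h3
  rw [dif_pos (Or.inl rfl), one_mul] at h3
  exact one_ne_zero h3

theorem IsComplete.lt_of_singleton {α : OrdinaryQuiver ℓ → ℝ}
    (h : IsComplete K {α}) (i : Fin ℓ) :
    α (OrdinaryQuiver.x i.succ) < α (OrdinaryQuiver.x i.castSucc) := by
  by_contra! hi
  refine not_nonempty_iso_twoStep (K := K) i (h _ _ ?_)
  rintro _ rfl
  exact hnType_twoStep_eq i 1 0 hi

end QuiverRep

/-! ### Decomposition into interval modules. -/

namespace QuiverRep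

open SubRep OrdinaryQuiver

variable {K : Type u} [Field K] {ℓ : ℕ} {V : QuiverRep K (OrdinaryQuiver ℓ)}

/-- The map of a persistence module along the edge `x_i → x_{i+1}`. -/
def next (V : QuiverRep K (OrdinaryQuiver ℓ)) (i : Fin ℓ) :
    V.obj (x i.castSucc) →ₗ[K] V.obj (x i.succ) :=
  V.map (Edge.edge i)

theorem exists_pushforward (w : ∀ i, V.obj (x i)) :
    ∃ p : ∀ i, V.obj (x i), p 0 = w 0 ∧ ∀ i, p (Fin.succ i) = w i.succ + V.next i (p i.castSucc) :=
  ⟨fun i => Fin.induction (motive := fun i => V.obj (x i)) (w 0)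
    (fun i q => w i.succ + V.next i q) i, rfl, fun _ => rfl⟩

theorem exists_pullback (η : ∀ i, V.obj (x i) →ₗ[K] K) :
    ∃ ξ : ∀ i, V.obj (x i) →ₗ[K] K, ξ (Fin.last ℓ) = η (Fin.last ℓ) ∧
      ∀ i, ξ (Fin.castSucc i) = η i.castSucc + ξ i.succ ∘ₗ V.next i :=
  ⟨fun i => Fin.reverseInduction (motive := fun i => V.obj (x i) →ₗ[K] K) (η (Fin.last ℓ))
    (fun i q => η i.castSucc + q ∘ₗ V.next i) i, Fin.reverseInduction_last,
    fun i => Fin.reverseInduction_castSucc i⟩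

/-- A nonzero persistence module has an interval summand, given by a trajectory `p` and a
compatible family `ξ` of functionals. -/
theorem exists_interval_summand (hV : ∃ i : Fin (ℓ + 1), Nontrivial (V.obj (x i))) :
    ∃ (a b : Fin (ℓ + 1)) (p : ∀ i, V.obj (x i)) (ξ : ∀ i, V.obj (x i) →ₗ[K] K), a ≤ b ∧
      (∀ i, ¬ (a ≤ i ∧ i ≤ b) → p i = 0) ∧ (∀ i, ¬ (a ≤ i ∧ i ≤ b) → ξ i = 0) ∧
      (∀ i, a ≤ i → i ≤ b → ξ i (p i) = 1) ∧
      (∀ i : Fin ℓ, a ≤ i.castSucc → V.next i (p i.castSucc) = p i.succ) ∧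
      ∀ i : Fin ℓ, i.succ ≤ b → ∀ v, ξ i.succ (V.next i v) = ξ i.castSucc v := by
  obtain ⟨a, ha, hmin⟩ := WellFounded.has_min (wellFounded_lt (α := Fin (ℓ + 1)))
    -- Taking `a` as the first nonzero vertex makes every functional pulled back to the left of `a`
    -- vanish, so that `ξ` is supported on `[a, b]`.
    {i | Nontrivial (V.obj (x i))} hV
  have hsub : ∀ i < a, ∀ v : V.obj (x i), v = 0 := by
    intro i hi v
    have : Subsingleton (V.obj (x i)) := not_nontrivial_iff_subsingleton.1 fun h => hmin i h hi
    exact Subsingleton.elim _ _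
  have ha : Nontrivial (V.obj (x a)) := ha
  obtain ⟨v, hv⟩ := exists_ne (0 : V.obj (x a))
  obtain ⟨p, hp0, hps⟩ := exists_pushforward (V := V) (Pi.single (M := fun i => V.obj (x i)) a v)
  have hpa : p a = v := by
    rcases Fin.eq_zero_or_eq_succ a with h | ⟨j, h⟩
    · subst h; rw [hp0, Pi.single_eq_same]
    · subst h
      rw [hps, hsub j.castSucc (Fin.castSucc_lt_succ) (p j.castSucc), map_zero, add_zero, Pi.single_eq_same]
  have hp : ∀ i : Fin ℓ, a ≤ i.castSucc → V.next i (p i.castSucc) = p i.succ := by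
    intro i hi
    rw [hps, Pi.single_eq_of_ne (hi.trans_lt Fin.castSucc_lt_succ).ne', zero_add]
  -- `b` is the last vertex that the trajectory of `v` reaches before dying; `ξ` is the pullback of
  -- a functional that is `1` there.
  obtain ⟨b, hb, hmax⟩ := WellFounded.has_min (wellFounded_gt (α := Fin (ℓ + 1)))
    {i | p i ≠ 0} ⟨a, fun h => hv (hpa.symm.trans h)⟩
  have hpb : ∀ i, b < i → p i = 0 := fun i hi => by_contra fun h => hmax i h hi
  have hab : a ≤ b := le_of_not_gt fun h => hb (hsub b h _)
  obtain ⟨η, hη⟩ : ∃ η : V.obj (x b) →ₗ[K] K, η (p b) = 1 := by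
    by_contra! hc
    refine hb ((Module.forall_dual_apply_eq_zero_iff K _).1 fun f => ?_)
    by_contra hf
    exact hc ((f (p b))⁻¹ • f) (by simp [hf])
  obtain ⟨ξ, hξl, hξs⟩ := exists_pullback (V := V)
    (Pi.single (M := fun i => V.obj (x i) →ₗ[K] K) b η)
  have hξ0 : ∀ i, b < i → ξ i = 0 := by
    intro i
    induction i using Fin.reverseInduction with
    | last => intro h; rw [hξl, Pi.single_eq_of_ne h.ne']
    | cast i ih =>
      intro h
      rw [hξs, Pi.single_eq_of_ne h.ne', ih (h.trans Fin.castSucc_lt_succ), LinearMap.zero_comp,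
        add_zero]
  have hξb : ξ b = η := by
    rcases Fin.eq_castSucc_or_eq_last b with ⟨j, h⟩ | h
    · subst h
      rw [hξs, hξ0 j.succ Fin.castSucc_lt_succ, LinearMap.zero_comp, add_zero, Pi.single_eq_same]
    · subst h; rw [hξl, Pi.single_eq_same]
  have hξ : ∀ i : Fin ℓ, i.succ ≤ b → ∀ v, ξ i.succ (V.next i v) = ξ i.castSucc v := by
    intro i hi v
    rw [hξs, Pi.single_eq_of_ne (Fin.castSucc_lt_succ.trans_le hi).ne, zero_add]
    rfl
  refine ⟨a, b, p, ξ, hab, fun i hi => ?_, fun i hi => ?_, fun i => ?_, hp, hξ⟩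
  · rcases lt_or_ge i a with h | h
    · exact hsub i h _
    · exact hpb i (lt_of_not_ge fun h' => hi ⟨h, h'⟩)
  · rcases lt_or_ge i a with h | h
    · exact LinearMap.ext fun v => by rw [hsub i h v, map_zero, map_zero]
    · exact hξ0 i (lt_of_not_ge fun h' => hi ⟨h, h'⟩)
  · induction i using Fin.reverseInduction with
    | last => intro _ h; rw [← le_antisymm (Fin.le_last b) h, hξb, hη]
    | cast i ih =>
      intro h1 h2
      rcases h2.eq_or_lt with h | h
      · rw [h, hξb, hη]
      · have h3 : i.succ ≤ b := Fin.castSucc_lt_iff_succ_le.1 h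
        rw [← hξ i h3, hp i h1, ih (h1.trans Fin.castSucc_lt_succ.le) h3]

/-- The inclusion of a subrepresentation. -/
def SubRep.incl (C : SubRep V) (i : Fin (ℓ + 1)) : C.toRep.obj (x i) →ₗ[K] V.obj (x i) :=
  (C.sub (x i)).subtype

/-- A decomposition of a persistence module into interval modules `[birth t, death t]`, given by
trajectories `vec t` and a dual family of functionals `coord t`. -/
structure Barcode (V : QuiverRep K (OrdinaryQuiver ℓ)) (ι : Type) [Fintype ι] where
  birth : ι → Fin (ℓ + 1)
  death : ι → Fin (ℓ + 1)
  birth_le_death : ∀ t, birth t ≤ death t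
  vec : ι → ∀ i, V.obj (x i)
  coord : ι → ∀ i, V.obj (x i) →ₗ[K] K
  vec_eq_zero : ∀ t i, ¬ (birth t ≤ i ∧ i ≤ death t) → vec t i = 0
  coord_eq_zero : ∀ t i, ¬ (birth t ≤ i ∧ i ≤ death t) → coord t i = 0
  coord_vec_self : ∀ t i, birth t ≤ i ∧ i ≤ death t → coord t i (vec t i) = 1
  coord_vec_of_ne : ∀ s t i, s ≠ t → coord s i (vec t i) = 0
  sum_coord_smul_vec : ∀ i v, ∑ t, coord t i v • vec t i = v
  next_vec : ∀ t (i : Fin ℓ), birth t ≤ i.castSucc ∧ i.castSucc ≤ death t →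
    V.next i (vec t i.castSucc) = vec t i.succ

theorem exists_barcode (V : QuiverRep K (OrdinaryQuiver ℓ)) :
    ∃ (ι : Type) (_ : Fintype ι), Nonempty (Barcode V ι) := by
  induction hn : ∑ i : Fin (ℓ + 1), V.dimVec (x i) using Nat.strong_induction_on generalizing V with
  | _ n ih =>
  by_cases hV : ∃ i : Fin (ℓ + 1), Nontrivial (V.obj (x i))
  swap
  · have h0 : ∀ (i : Fin (ℓ + 1)) (v : V.obj (x i)), v = 0 := fun i v => by
      have : Subsingleton (V.obj (x i)) := not_nontrivial_iff_subsingleton.1 fun h => hV ⟨i, h⟩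
      exact Subsingleton.elim _ _
    exact ⟨Empty, inferInstance, ⟨{
      birth := Empty.elim
      death := Empty.elim
      birth_le_death := fun t => t.elim
      vec := fun t => t.elim
      coord := fun t => t.elim
      vec_eq_zero := fun t => t.elim
      coord_eq_zero := fun t => t.elim
      coord_vec_self := fun t => t.elim
      coord_vec_of_ne := fun t => t.elim
      sum_coord_smul_vec := fun i v => (h0 i _).trans (h0 i v).symm
      next_vec := fun t => t.elim }⟩⟩
  obtain ⟨a, b, p, ξ, hab, hp0, hξ0, hξp, hp, hξ⟩ := exists_interval_summand hV
  -- The kernel of `ξ` is a complement of the interval spanned by `p`; its total dimension is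
  -- smaller, so induction applies.
  let C : SubRep V :=
    { sub := fun i => LinearMap.ker (ξ i)
      le_comap := by
        rintro _ _ ⟨i⟩ v hv
        have hv : ξ i.castSucc v = 0 := hv
        change ξ i.succ (V.next i v) = 0
        by_cases h : i.succ ≤ b
        · rw [hξ i h, hv]
        · rw [hξ0 i.succ fun h' => h h'.2, LinearMap.zero_apply] }
  have hC : ∀ (i : Fin (ℓ + 1)) (v : V.obj (x i)), v ∈ C.sub (x i) ↔ ξ i v = 0 := fun i v => Iff.rfl
  have hlt : ∑ i : Fin (ℓ + 1), C.toRep.dimVec (x i) < n := by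
    rw [← hn]
    refine Finset.sum_lt_sum (fun i _ => Submodule.finrank_le (C.sub (x i)))
      ⟨a, Finset.mem_univ a, Submodule.finrank_lt fun h => ?_⟩
    have h1 : p a ∈ C.sub (x a) := by rw [h]; trivial
    rw [hC, hξp a le_rfl hab] at h1
    exact one_ne_zero h1
  obtain ⟨ι, hι, ⟨B⟩⟩ := ih _ hlt C.toRep rfl
  have hq : ∀ (i : Fin (ℓ + 1)) (v : V.obj (x i)), v - ξ i v • p i ∈ C.sub (x i) := by
    intro i v
    rw [hC, map_sub, map_smul, smul_eq_mul]
    by_cases h : a ≤ i ∧ i ≤ b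
    · rw [hξp i h.1 h.2, mul_one, sub_self]
    · rw [hξ0 i h]; simp
  -- The projection onto `C` along `p`, used to extend the functionals of `C` to `V`.
  let q : ∀ i : Fin (ℓ + 1), V.obj (x i) →ₗ[K] C.toRep.obj (x i) := fun i =>
    LinearMap.codRestrict (C.sub (x i)) (LinearMap.id - (ξ i).smulRight (p i)) (hq i)
  have hinj : ∀ i, Function.Injective (C.incl i) := fun i => Subtype.val_injective
  have hqv : ∀ (i : Fin (ℓ + 1)) (v : V.obj (x i)), C.incl i (q i v) = v - ξ i v • p i :=
    fun i v => rfl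
  have hξC : ∀ i v, ξ i (C.incl i v) = 0 := fun i v => (hC i _).1 v.2
  have hqp : ∀ i, q i (p i) = 0 := by
    intro i
    apply hinj
    rw [hqv, map_zero]
    by_cases h : a ≤ i ∧ i ≤ b
    · rw [hξp i h.1 h.2, one_smul, sub_self]
    · rw [hp0 i h, smul_zero, sub_zero]
  have hqC : ∀ i v, q i (C.incl i v) = v := by
    intro i v
    apply hinj
    rw [hqv, hξC, zero_smul, sub_zero]
  refine ⟨Option ι, inferInstance, ⟨{
      birth := fun t => t.elim a B.birth
      death := fun t => t.elim b B.death
      birth_le_death := ?_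
      vec := fun t i => t.elim (p i) fun t => C.incl i (B.vec t i)
      coord := fun t i => t.elim (ξ i) fun t => B.coord t i ∘ₗ q i
      vec_eq_zero := ?_
      coord_eq_zero := ?_
      coord_vec_self := ?_
      coord_vec_of_ne := ?_
      sum_coord_smul_vec := ?_
      next_vec := ?_ }⟩⟩
  · rintro (_ | t)
    exacts [hab, B.birth_le_death t]
  · rintro (_ | t) i h
    · exact hp0 i h
    · exact congrArg Subtype.val (B.vec_eq_zero t i h)
  · rintro (_ | t) i h
    · exact hξ0 i h
    · change B.coord t i ∘ₗ q i = 0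
      rw [B.coord_eq_zero t i h]
      exact LinearMap.zero_comp _
  · rintro (_ | t) i h
    · exact hξp i h.1 h.2
    · change B.coord t i (q i (C.incl i (B.vec t i))) = 1
      rw [hqC]
      exact B.coord_vec_self t i h
  · rintro (_ | s) (_ | t) i h
    · exact absurd rfl h
    · exact hξC i _
    · change B.coord s i (q i (p i)) = 0
      rw [hqp]
      exact map_zero (B.coord s i)
    · change B.coord s i (q i (C.incl i (B.vec t i))) = 0
      rw [hqC]
      exact B.coord_vec_of_ne s t i fun h' => h (congrArg some h')
  · intro i v
    rw [Fintype.sum_option]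
    have h1 := congrArg (C.incl i) (B.sum_coord_smul_vec i (q i v))
    rw [map_sum, hqv] at h1
    simp only [map_smul] at h1
    refine (congrArg (ξ i v • p i + ·) h1).trans ?_
    exact add_sub_cancel _ _
  · rintro (_ | t) i h
    · exact hp i h.1
    · exact congrArg Subtype.val (B.next_vec t i h)

end QuiverRep

/-! ### Slopes of intervals when `α` strictly decreases. -/

/-- Here `s` is the mean of `f` over `I`. If the smallest values, those on `A`, had a positive total
excess over `s`, some value on `A` would exceed `s`, hence so would all values off `A`, and the
total over `I` would be positive. -/
theorem Finset.sum_sub_nonpos_of_le {ι : Type*} {I A : Finset ι} (hA : A ⊆ I) {f : ι → ℝ} {s : ℝ}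
    (hI : ∑ i ∈ I, (f i - s) = 0) (h : ∀ i ∈ A, ∀ j ∈ I, j ∉ A → f i ≤ f j) :
    ∑ i ∈ A, (f i - s) ≤ 0 := by
  classical
  by_contra! hc
  obtain ⟨i, hi, hpos⟩ : ∃ i ∈ A, 0 < f i - s := by
    by_contra! h0
    exact hc.not_ge (Finset.sum_nonpos h0)
  have h1 : 0 ≤ ∑ j ∈ I \ A, (f j - s) := Finset.sum_nonneg fun j hj => by
    obtain ⟨hj, hj'⟩ := Finset.mem_sdiff.1 hj
    linarith [h i hi j hj hj']
  have := Finset.sum_sdiff (f := fun i => f i - s) hA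
  linarith

namespace QuiverRep

open SubRep OrdinaryQuiver Finset

variable {K : Type u} [Field K] {ℓ : ℕ} {V W : QuiverRep K (OrdinaryQuiver ℓ)}

/-- The slope of the interval module `[a, b]`. -/
noncomputable def intervalSlope (α : OrdinaryQuiver ℓ → ℝ) (a b : Fin (ℓ + 1)) : ℝ :=
  (∑ i ∈ Icc a b, α (x i)) / (#(Icc a b) : ℝ)

theorem sum_sub_intervalSlope (α : OrdinaryQuiver ℓ → ℝ) {a b : Fin (ℓ + 1)} (h : a ≤ b) :
    ∑ i ∈ Icc a b, (α (x i) - intervalSlope α a b) = 0 := by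
  have : (#(Icc a b) : ℝ) ≠ 0 := Nat.cast_ne_zero.2 (Finset.card_pos.2 ⟨a, by simp [h]⟩).ne'
  rw [Finset.sum_sub_distrib, Finset.sum_const, nsmul_eq_mul, intervalSlope,
    mul_div_cancel₀ _ this, sub_self]

section Slopes

variable {α : OrdinaryQuiver ℓ → ℝ} (hα : StrictAnti fun i : Fin (ℓ + 1) => α (x i))
include hα

theorem le_intervalSlope {a b : Fin (ℓ + 1)} (h : a ≤ b) : α (x b) ≤ intervalSlope α a b := by
  by_contra! hc
  refine (Finset.sum_pos (fun i hi => ?_) ⟨a, by simp [h]⟩).ne' (sum_sub_intervalSlope α h)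
  have := hα.antitone (Finset.mem_Icc.1 hi).2
  linarith

theorem intervalSlope_le {a b : Fin (ℓ + 1)} (h : a ≤ b) : intervalSlope α a b ≤ α (x a) := by
  by_contra! hc
  refine (Finset.sum_neg (fun i hi => ?_) ⟨a, by simp [h]⟩).ne (sum_sub_intervalSlope α h)
  have := hα.antitone (Finset.mem_Icc.1 hi).1
  linarith

theorem intervalSlope_lt_of_lt {c d a b : Fin (ℓ + 1)} (hcd : c ≤ d) (hda : d < a) (hab : a ≤ b) :
    intervalSlope α a b < intervalSlope α c d :=
  (intervalSlope_le hα hab).trans_lt ((hα hda).trans_le (le_intervalSlope hα hcd))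

theorem intervalSlope_strictAnti_right {a b b' : Fin (ℓ + 1)} (hab : a ≤ b) (hb : b < b') :
    intervalSlope α a b' < intervalSlope α a b := by
  by_contra! hc
  have h1 := sum_sub_intervalSlope α (hab.trans hb.le)
  have h2 := sum_sub_intervalSlope α hab
  -- The added vertices lie right of `b`, where `α` is below `α (x b)`, itself at most the old mean.
  have h3 : ∑ i ∈ Icc a b', (α (x i) - intervalSlope α a b) < 0 := by
    rw [← Finset.sum_sdiff (Finset.Icc_subset_Icc_right hb.le), h2, add_zero]
    refine Finset.sum_neg (fun i hi => ?_) ⟨b', by simp [hab.trans hb.le, hb]⟩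
    simp only [Finset.mem_sdiff, Finset.mem_Icc, not_and, not_le] at hi
    have h4 := hα (hi.2 hi.1.1)
    have h5 := le_intervalSlope hα hab
    linarith
  have h6 : ∑ i ∈ Icc a b', (α (x i) - intervalSlope α a b') ≤
      ∑ i ∈ Icc a b', (α (x i) - intervalSlope α a b) :=
    Finset.sum_le_sum fun i _ => by linarith
  linarith

theorem eq_of_intervalSlope_eq {a b b' : Fin (ℓ + 1)} (hab : a ≤ b) (hab' : a ≤ b')
    (h : intervalSlope α a b = intervalSlope α a b') : b = b' := by
  rcases lt_trichotomy b b' with hb | hb | hb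
  · exact absurd h (intervalSlope_strictAnti_right hα hab hb).ne'
  · exact hb
  · exact absurd h (intervalSlope_strictAnti_right hα hab' hb).ne

end Slopes

/-! ### The chain obtained by adding bars in order of slope. -/

namespace Barcode

variable {ι : Type} [Fintype ι] (B : Barcode V ι)

theorem coord_sum (t : ι) (i : Fin (ℓ + 1)) (c : ι → K) :
    B.coord t i (∑ s, c s • B.vec s i) =
      if B.birth t ≤ i ∧ i ≤ B.death t then c t else 0 := by
  rw [map_sum, Finset.sum_eq_single t]
  · rw [map_smul, smul_eq_mul]
    split_ifs with h
    · rw [B.coord_vec_self t i h, mul_one]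
    · rw [B.vec_eq_zero t i h, map_zero, mul_zero]
  · intro s _ hs
    rw [map_smul, B.coord_vec_of_ne t s i hs.symm, smul_zero]
  · simp

theorem next_eq_sum (i : Fin ℓ) (v : V.obj (x i.castSucc)) :
    V.next i v = ∑ s, B.coord s i.castSucc v • B.vec s i.succ := by
  conv_lhs => rw [← B.sum_coord_smul_vec i.castSucc v, map_sum]
  refine Finset.sum_congr rfl fun s _ => ?_
  rw [map_smul]
  by_cases h : B.birth s ≤ i.castSucc ∧ i.castSucc ≤ B.death s
  · rw [B.next_vec s i h]
  · rw [B.coord_eq_zero s _ h, LinearMap.zero_apply, zero_smul, zero_smul]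

/-- Compatibility of the functionals with the edge maps follows from that of the trajectories by
duality; the zero branch includes the edge leaving the death vertex. -/
theorem coord_next (t : ι) (i : Fin ℓ) (v : V.obj (x i.castSucc)) :
    B.coord t i.succ (V.next i v) =
      if B.birth t ≤ i.succ ∧ i.succ ≤ B.death t then B.coord t i.castSucc v else 0 := by
  rw [B.next_eq_sum, B.coord_sum]

/-- The sum of the interval modules indexed by `S`. -/
def span (S : Set ι) : SubRep V where
  sub i :=
    { carrier := {v | ∀ t, t ∉ S → B.coord t i v = 0}
      add_mem' := fun ha hb t ht => by rw [map_add, ha t ht, hb t ht, add_zero]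
      zero_mem' := fun t _ => map_zero _
      smul_mem' := fun c v hv t ht => by rw [map_smul, hv t ht, smul_zero] }
  le_comap := by
    rintro _ _ ⟨i⟩ v hv t ht
    change B.coord t i.succ (V.next i v) = 0
    rw [B.coord_next, hv t ht, ite_self]

theorem span_empty : B.span ∅ = ⊥ := by
  refine SubRep.ext (funext fun i => (Submodule.eq_bot_iff _).2 fun v hv => ?_)
  rw [← B.sum_coord_smul_vec i v]
  exact Finset.sum_eq_zero fun t _ => by rw [hv t (Set.notMem_empty t), zero_smul]

theorem span_univ : B.span Set.univ = ⊤ :=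
  SubRep.ext (funext fun _ => eq_top_iff.2 fun _ _ t ht => absurd (Set.mem_univ t) ht)

theorem span_mono {S T : Set ι} (h : S ⊆ T) : B.span S ≤ B.span T :=
  fun _ _ hv t ht => hv t fun ht' => ht (h ht')

-- On `X` the kernel of `coord t` is exactly the span of `S`, so `X` exceeds it by at most one
-- dimension at each vertex.
open Classical in
theorem dim_between {S : Set ι} {t : ι} {X : SubRep V} (ht : t ∉ S) (h1 : B.span S ≤ X)
    (h2 : X ≤ B.span (insert t S)) (i : Fin (ℓ + 1)) :
    X.dim (x i) = (B.span S).dim (x i) +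
      if ∃ v ∈ X.sub (x i), B.coord t i v ≠ 0 then 1 else 0 := by
  have h := LinearMap.finrank_range_add_finrank_ker ((B.coord t i).domRestrict (X.sub (x i)))
  have hk : LinearMap.ker ((B.coord t i).domRestrict (X.sub (x i))) =
      ((B.span S).sub (x i)).submoduleOf (X.sub (x i)) := by
    ext ⟨v, hv⟩
    change B.coord t i v = 0 ↔ ∀ s, s ∉ S → B.coord s i v = 0
    refine ⟨fun h0 s hs => ?_, fun h0 => h0 t ht⟩
    by_cases hst : s = t
    · rw [hst, h0]
    · exact h2 (x i) hv s fun hs' => (Set.mem_insert_iff.1 hs').elim hst hs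
  rw [hk, (Submodule.submoduleOfEquivOfLe (h1 (x i))).finrank_eq] at h
  have hr : Module.finrank K (LinearMap.range ((B.coord t i).domRestrict (X.sub (x i)))) =
      if ∃ v ∈ X.sub (x i), B.coord t i v ≠ 0 then 1 else 0 := by
    split_ifs with hv
    · obtain ⟨v, hv, hv0⟩ := hv
      have : LinearMap.range ((B.coord t i).domRestrict (X.sub (x i))) = ⊤ :=
        LinearMap.range_eq_top.2 (LinearMap.surjective fun h0 =>
          hv0 (LinearMap.congr_fun h0 ⟨v, hv⟩))
      rw [this, finrank_top, Module.finrank_self]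
    · have : (B.coord t i).domRestrict (X.sub (x i)) = 0 := by
        ext ⟨v, hv'⟩
        by_contra h0
        exact hv ⟨v, hv', h0⟩
      rw [this, LinearMap.range_zero, finrank_bot]
  rw [hr] at h
  rw [add_comm]
  exact h.symm

theorem exists_coord_ne_zero_iff_of_insert {S : Set ι} {t : ι} (i : Fin (ℓ + 1)) :
    (∃ v ∈ (B.span (insert t S)).sub (x i), B.coord t i v ≠ 0) ↔
      i ∈ Icc (B.birth t) (B.death t) := by
  rw [Finset.mem_Icc]
  constructor
  · rintro ⟨v, -, hv⟩
    by_contra h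
    rw [B.coord_eq_zero t i h] at hv
    exact hv rfl
  · intro h
    refine ⟨B.vec t i, fun s hs => ?_, ?_⟩
    · exact B.coord_vec_of_ne s t i fun h => hs (h ▸ Set.mem_insert s S)
    · rw [B.coord_vec_self t i h]; exact one_ne_zero

theorem dim_span_insert {S : Set ι} {t : ι} (ht : t ∉ S) (i : Fin (ℓ + 1)) :
    (B.span (insert t S)).dim (x i) = (B.span S).dim (x i) +
      if i ∈ Icc (B.birth t) (B.death t) then 1 else 0 := by
  classical
  rw [B.dim_between ht (B.span_mono (Set.subset_insert t S)) le_rfl]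
  simp only [B.exists_coord_ne_zero_iff_of_insert]

open Classical in
theorem wt_sub_mul_rk_between (α : OrdinaryQuiver ℓ → ℝ) (s : ℝ) {S : Set ι} {t : ι} {X : SubRep V}
    (ht : t ∉ S) (h1 : B.span S ≤ X) (h2 : X ≤ B.span (insert t S)) :
    wt α X - wt α (B.span S) - s * (X.rk - (B.span S).rk) =
      ∑ i : Fin (ℓ + 1) with ∃ v ∈ X.sub (x i), B.coord t i v ≠ 0, (α (x i) - s) := by
  have h : ∀ i : Fin (ℓ + 1), (X.dim (x i) : ℝ) - (B.span S).dim (x i) =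
      if ∃ v ∈ X.sub (x i), B.coord t i v ≠ 0 then 1 else 0 := fun i => by
    rw [B.dim_between ht h1 h2]; push_cast; ring
  rw [wt, wt, rk, rk, ← Finset.sum_sub_distrib, ← Finset.sum_sub_distrib, Finset.mul_sum,
    ← Finset.sum_sub_distrib, Finset.sum_filter]
  refine Finset.sum_congr rfl fun i _ => ?_
  rw [← mul_sub]
  change α i * ((X.dim (x i) : ℝ) - (B.span S).dim (x i)) -
    s * ((X.dim (x i) : ℝ) - (B.span S).dim (x i)) = _
  rw [h i, ← sub_mul, mul_ite, mul_one, mul_zero]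

theorem wt_span_insert (α : OrdinaryQuiver ℓ → ℝ) {S : Set ι} {t : ι} (ht : t ∉ S) :
    wt α (B.span (insert t S)) - wt α (B.span S) =
      intervalSlope α (B.birth t) (B.death t) *
        ((B.span (insert t S)).rk - (B.span S).rk) := by
  classical
  rw [← sub_eq_zero, B.wt_sub_mul_rk_between α _ ht (B.span_mono (Set.subset_insert t S)) le_rfl]
  simp only [B.exists_coord_ne_zero_iff_of_insert, Finset.filter_univ_mem]
  exact sum_sub_intervalSlope α (B.birth_le_death t)

theorem wt_le_between {α : OrdinaryQuiver ℓ → ℝ} (hα : StrictAnti fun i : Fin (ℓ + 1) => α (x i))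
    {S : Set ι} {t : ι} {X : SubRep V} (ht : t ∉ S) (h1 : B.span S ≤ X)
    (h2 : X ≤ B.span (insert t S)) :
    wt α X - wt α (B.span S) ≤
      intervalSlope α (B.birth t) (B.death t) * (X.rk - (B.span S).rk) := by
  classical
  rw [← sub_nonpos, B.wt_sub_mul_rk_between α _ ht h1 h2]
  refine Finset.sum_sub_nonpos_of_le ?_ (sum_sub_intervalSlope α (B.birth_le_death t)) ?_
  · intro i hi
    obtain ⟨v, hv, hv0⟩ := (Finset.mem_filter.1 hi).2
    exact B.exists_coord_ne_zero_iff_of_insert (S := S) i |>.1 ⟨v, h2 _ hv, hv0⟩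
  · intro i hi j hj hjA
    have hi := (Finset.mem_filter.1 hi).2
    -- The vertices where `coord t` is nonzero on `X` are closed under moving right within the bar,
    -- so a vertex of the bar outside this set lies to the left of `i`.
    refine hα.antitone (le_of_not_gt fun hij => hjA ?_)
    rw [Finset.mem_filter]
    refine ⟨Finset.mem_univ j, ?_⟩
    rw [Finset.mem_Icc] at hj
    have hbi : B.birth t ≤ i := by
      obtain ⟨v, -, hv0⟩ := hi
      by_contra h
      rw [B.coord_eq_zero t i fun h' => h h'.1] at hv0
      exact hv0 rfl
    clear hjA
    induction j using Fin.induction with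
    | zero => exact absurd hij (Fin.not_lt_zero i)
    | succ j ih =>
      have hij' : i ≤ j.castSucc := Fin.le_castSucc_iff.2 hij
      have hd : j.castSucc ≤ B.death t := Fin.castSucc_lt_succ.le.trans hj.2
      obtain ⟨v, hv, hv0⟩ : ∃ v ∈ X.sub (x j.castSucc), B.coord t j.castSucc v ≠ 0 := by
        rcases hij'.eq_or_lt with h | h
        · rwa [← h]
        · exact ih ⟨hbi.trans hij', hd⟩ h
      refine ⟨V.next j v, X.le_comap (Edge.edge j) hv, ?_⟩
      rwa [B.coord_next, if_pos hj]

theorem exists_weakHN {α : OrdinaryQuiver ℓ → ℝ}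
    (hα : StrictAnti fun i : Fin (ℓ + 1) => α (x i)) :
    ∃ G : WeakHN α V, ∀ μ (i : Fin (ℓ + 1)), G.jump μ (x i) =
      #{t | intervalSlope α (B.birth t) (B.death t) = μ ∧
        i ∈ Icc (B.birth t) (B.death t)} := by
  classical
  let sl : ι → ℝ := fun t => intervalSlope α (B.birth t) (B.death t)
  -- Sorting the negated slopes in increasing order lists the bars by decreasing slope.
  obtain ⟨e, he⟩ : ∃ e : Fin (Fintype.card ι) ≃ ι, Antitone (sl ∘ e) := by
    refine ⟨(Tuple.sort fun k => -sl ((Fintype.equivFin ι).symm k)).trans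
      (Fintype.equivFin ι).symm, fun i j hij => ?_⟩
    exact neg_le_neg_iff.1
      (Tuple.monotone_sort (fun k => -sl ((Fintype.equivFin ι).symm k)) hij)
  -- The first `k` bars in this order.
  let S : ℕ → Set ι := fun k => {t | (e.symm t : ℕ) < k}
  have hS : ∀ k (h : k < Fintype.card ι), S (k + 1) = insert (e ⟨k, h⟩) (S k) := by
    intro k h
    ext t
    simp only [S, Set.mem_insert_iff, Set.mem_ofPred_eq]
    rw [← Equiv.symm_apply_eq, Fin.ext_iff]
    simp only
    omega
  have hnot : ∀ k (h : k < Fintype.card ι), e ⟨k, h⟩ ∉ S k := fun k h => by simp [S]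
  let G : WeakHN α V :=
    { length := Fintype.card ι
      step := fun k => B.span (S k)
      slp := fun k => if h : k < Fintype.card ι then sl (e ⟨k, h⟩) else 0
      step_zero := by
        have : S 0 = ∅ := by ext; simp [S]
        rw [this, B.span_empty]
      step_length := by
        have : S (Fintype.card ι) = Set.univ := by ext; simp [S]
        rw [this, B.span_univ]
      step_le := fun k h => by rw [hS k h]; exact B.span_mono (Set.subset_insert _ _)
      wt_eq := fun k h => by rw [hS k h, dif_pos h]; exact B.wt_span_insert α (hnot k h)
      wt_le := fun k h X h1 h2 => by
        rw [hS k h] at h2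
        rw [dif_pos h]
        exact B.wt_le_between hα (hnot k h) h1 h2
      slp_anti := fun k l hkl hl => by
        rw [dif_pos hl, dif_pos (hkl.trans_lt hl)]
        exact he (show (⟨k, _⟩ : Fin (Fintype.card ι)) ≤ ⟨l, hl⟩ from hkl) }
  refine ⟨G, fun μ i => ?_⟩
  rw [WeakHN.jump, Finset.sum_filter, Finset.card_filter, Nat.cast_sum, ← Equiv.sum_comp e]
  refine (Finset.sum_range _).trans (Finset.sum_congr rfl fun k _ => ?_)
  have h1 : G.slp k = sl (e k) := dif_pos k.2
  have h2 : (G.step (k + 1)).dim (x i) = (G.step k).dim (x i) +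
      if i ∈ Icc (B.birth (e k)) (B.death (e k)) then 1 else 0 := by
    change (B.span (S (k + 1))).dim (x i) = _
    rw [hS k k.2, B.dim_span_insert (hnot k k.2)]
  rw [h1, h2, ite_and]
  push_cast
  by_cases h : sl (e k) = μ
  · rw [if_pos h, if_pos h]; ring
  · rw [if_neg h, if_neg h]

/-- The number of bars `[a, b]`, in terms of the bars of the same slope. -/
theorem card_eq_add {α : OrdinaryQuiver ℓ → ℝ} (hα : StrictAnti fun i : Fin (ℓ + 1) => α (x i))
    {a b : Fin (ℓ + 1)} (hab : a ≤ b) {j : Fin ℓ} (hj : a = j.succ) :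
    #{t | intervalSlope α (B.birth t) (B.death t) = intervalSlope α a b ∧
        a ∈ Icc (B.birth t) (B.death t)} =
      #{t | (B.birth t, B.death t) = (a, b)} +
      #{t | intervalSlope α (B.birth t) (B.death t) = intervalSlope α a b ∧
        j.castSucc ∈ Icc (B.birth t) (B.death t)} := by
  classical
  have hja : j.castSucc < a := hj ▸ Fin.castSucc_lt_succ
  rw [← Finset.card_union_of_disjoint]
  · congr 1
    ext t
    simp only [Finset.mem_filter, Finset.mem_univ, true_and, Finset.mem_union, Prod.mk.injEq,
      Finset.mem_Icc]
    constructor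
    · rintro ⟨h1, h2, h3⟩
      rcases h2.eq_or_lt with h | h
      · rw [h] at h1
        -- Among bars born at `a`, the slope determines the death.
        exact Or.inl ⟨h, eq_of_intervalSlope_eq hα h3 hab h1⟩
      · have h4 : B.birth t ≤ j.castSucc := Fin.le_castSucc_iff.2 (hj ▸ h)
        exact Or.inr ⟨h1, h4, hja.le.trans h3⟩
    · rintro (⟨h1, h2⟩ | ⟨h1, h2, h3⟩)
      · rw [h1, h2]; exact ⟨rfl, le_rfl, hab⟩
      · refine ⟨h1, h2.trans hja.le, ?_⟩
        -- A bar dying before `a` would have slope larger than that of `[a, b]`.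
        by_contra! h
        exact (intervalSlope_lt_of_lt hα (B.birth_le_death t) h hab).ne' h1
  · rw [Finset.disjoint_filter]
    rintro t _ h1 ⟨-, h2⟩
    rw [(Prod.mk.inj h1).1, Finset.mem_Icc] at h2
    exact absurd h2.1 (not_le.2 hja)

theorem card_eq_of_zero {α : OrdinaryQuiver ℓ → ℝ}
    (hα : StrictAnti fun i : Fin (ℓ + 1) => α (x i)) (b : Fin (ℓ + 1)) :
    #{t | intervalSlope α (B.birth t) (B.death t) = intervalSlope α 0 b ∧
        0 ∈ Icc (B.birth t) (B.death t)} = #{t | (B.birth t, B.death t) = (0, b)} := by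
  congr 1
  ext t
  simp only [Finset.mem_filter, Finset.mem_univ, true_and, Prod.mk.injEq, Finset.mem_Icc]
  constructor
  · rintro ⟨h1, h2, h3⟩
    have h := Fin.le_zero_iff.1 h2
    rw [h] at h1
    exact ⟨h, eq_of_intervalSlope_eq hα h3 (Fin.zero_le b) h1⟩
  · rintro ⟨h1, h2⟩
    rw [h1, h2]; exact ⟨rfl, le_rfl, Fin.zero_le b⟩

variable {κ : Type} [Fintype κ] (C : Barcode W κ)

/-- The comparison map between persistence modules with matching barcodes. -/
def compare (σ : ι → κ) (i : Fin (ℓ + 1)) : V.obj (x i) →ₗ[K] W.obj (x i) :=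
  ∑ t, (B.coord t i).smulRight (C.vec (σ t) i)

theorem compare_apply (σ : ι → κ) (i : Fin (ℓ + 1)) (v : V.obj (x i)) :
    B.compare C σ i v = ∑ t, B.coord t i v • C.vec (σ t) i := by
  simp [compare]

/-- In the two dual bases the comparison map only relabels coordinates; this yields both its inverse
and its compatibility with edges. -/
theorem coord_compare (σ : ι ≃ κ) (h1 : ∀ t, C.birth (σ t) = B.birth t)
    (h2 : ∀ t, C.death (σ t) = B.death t) (t : ι) (i : Fin (ℓ + 1)) (v : V.obj (x i)) :
    C.coord (σ t) i (B.compare C σ i v) = B.coord t i v := by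
  have : B.compare C σ i v = ∑ s, B.coord (σ.symm s) i v • C.vec s i := by
    rw [compare_apply, ← Equiv.sum_comp σ]
    simp
  rw [this, C.coord_sum, h1, h2, Equiv.symm_apply_apply]
  split_ifs with h
  · rfl
  · rw [B.coord_eq_zero t i h, LinearMap.zero_apply]

theorem compare_compare (σ : ι ≃ κ) (h1 : ∀ t, C.birth (σ t) = B.birth t)
    (h2 : ∀ t, C.death (σ t) = B.death t) (i : Fin (ℓ + 1)) (v : V.obj (x i)) :
    C.compare B σ.symm i (B.compare C σ i v) = v := by
  rw [compare_apply, ← Equiv.sum_comp σ]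
  simp only [B.coord_compare C σ h1 h2, Equiv.symm_apply_apply]
  exact B.sum_coord_smul_vec i v

/-- Persistence modules with matching barcodes are isomorphic. -/
theorem nonempty_iso (σ : ι ≃ κ) (h1 : ∀ t, C.birth (σ t) = B.birth t)
    (h2 : ∀ t, C.death (σ t) = B.death t) : Nonempty (Iso V W) := by
  have h1' : ∀ t, B.birth (σ.symm t) = C.birth t := fun t => by
    rw [← h1, Equiv.apply_symm_apply]
  have h2' : ∀ t, B.death (σ.symm t) = C.death t := fun t => by
    rw [← h2, Equiv.apply_symm_apply]
  refine ⟨{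
    app := fun i => LinearEquiv.ofLinearMap (B.compare C σ i) (C.compare B σ.symm i)
      (LinearMap.ext fun w => ?_) (LinearMap.ext fun v => B.compare_compare C σ h1 h2 i v)
    comm := ?_ }⟩
  · exact C.compare_compare B σ.symm h1' h2' i w
  · rintro _ _ ⟨i⟩ v
    change B.compare C σ i.succ (V.next i v) = W.next i (B.compare C σ i.castSucc v)
    rw [C.next_eq_sum, compare_apply, ← Equiv.sum_comp σ]
    refine Finset.sum_congr rfl fun t _ => ?_
    rw [B.coord_compare C σ h1 h2, B.coord_next]
    split_ifs with h
    · rfl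
    · rw [C.vec_eq_zero (σ t) i.succ (by rw [h1, h2]; exact h), smul_zero, smul_zero]

theorem nonempty_iso_of_card_eq
    (h : ∀ a b, a ≤ b → #{t | (B.birth t, B.death t) = (a, b)} =
      #{t | (C.birth t, C.death t) = (a, b)}) : Nonempty (Iso V W) := by
  have hc : ∀ p : Fin (ℓ + 1) × Fin (ℓ + 1),
      Nonempty ({t // (B.birth t, B.death t) = p} ≃ {t // (C.birth t, C.death t) = p}) := by
    rintro ⟨a, b⟩
    refine ⟨Fintype.equivOfCardEq ?_⟩
    rw [Fintype.card_subtype, Fintype.card_subtype]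
    by_cases hab : a ≤ b
    · exact h a b hab
    · rw [Finset.card_eq_zero.2, Finset.card_eq_zero.2] <;>
      · refine Finset.filter_eq_empty_iff.2 fun t _ ht => hab ?_
        rw [← (Prod.mk.inj ht).1, ← (Prod.mk.inj ht).2]
        first | exact B.birth_le_death t | exact C.birth_le_death t
  let e := fun p => (hc p).some
  have hσ := fun t => Equiv.ofFiberEquiv_map e t
  exact B.nonempty_iso C (Equiv.ofFiberEquiv e) (fun t => (Prod.mk.inj (hσ t)).1)
    fun t => (Prod.mk.inj (hσ t)).2

end Barcode

/-! ### Recovering jumps from the type, and the conclusion. -/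

section General

variable {Q : Type v} [Quiver.{w} Q] [Fintype Q] {V W : QuiverRep K Q} {α : Q → ℝ}

theorem WeakHN.sum_mul_jump (G : WeakHN α V) (μ : ℝ) :
    ∑ q, α q * G.jump μ q = μ * ∑ q, G.jump μ q := by
  simp only [WeakHN.jump, Finset.mul_sum]
  rw [Finset.sum_comm, Finset.sum_comm (s := univ)]
  refine Finset.sum_congr rfl fun t ht => ?_
  obtain ⟨ht', rfl⟩ := Finset.mem_filter.1 ht
  have h := G.wt_eq t (Finset.mem_range.1 ht')
  rw [wt, wt, rk, rk, ← Finset.sum_sub_distrib, ← Finset.sum_sub_distrib, Finset.mul_sum] at h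
  simpa only [mul_sub] using h

/-- A nonzero jump at `μ` has slope `μ`, so it is an entry of the common type and must be the jump
of the other chain at `μ`. A zero jump leaves no entry, so the general case applies this from both
sides. -/
theorem WeakHN.jump_eq_of_hnType_eq_of_ne_zero (G : WeakHN α V) (H : WeakHN α W)
    (h : hnType α V = hnType α W) {μ : ℝ} {v : Q → ℕ} (hv : ∀ q, G.jump μ q = v q) (h0 : v ≠ 0)
    (q : Q) : H.jump μ q = v q := by
  have hμ : dimSlope α v = μ := by
    have h1 := G.sum_mul_jump μ
    simp only [hv] at h1
    rw [dimSlope, h1, mul_div_cancel_right₀ _ (sum_pos_of_ne_zero h0).ne']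
  subst hμ
  exact (((H.mem_hnType_iff v).1 (h ▸ (G.mem_hnType_iff v).2 ⟨h0, fun q => (hv q).symm⟩)).2 q).symm

theorem WeakHN.jump_eq_of_hnType_eq (G : WeakHN α V) (H : WeakHN α W)
    (h : hnType α V = hnType α W) {μ : ℝ} {v w : Q → ℕ} (hv : ∀ q, G.jump μ q = v q)
    (hw : ∀ q, H.jump μ q = w q) : v = w := by
  funext q
  by_cases h0 : v = 0
  · by_cases h1 : w = 0
    · rw [h0, h1]
    · exact_mod_cast (hv q).symm.trans (H.jump_eq_of_hnType_eq_of_ne_zero G h.symm hw h1 q)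
  · exact_mod_cast (G.jump_eq_of_hnType_eq_of_ne_zero H h hv h0 q).symm.trans (hw q)

end General

theorem isComplete_singleton {α : OrdinaryQuiver ℓ → ℝ}
    (hα : StrictAnti fun i : Fin (ℓ + 1) => α (x i)) : IsComplete K {α} := by
  intro V W hVW
  obtain ⟨ι, _, ⟨B⟩⟩ := exists_barcode V
  obtain ⟨κ, _, ⟨C⟩⟩ := exists_barcode W
  obtain ⟨G, hG⟩ := B.exists_weakHN hα
  obtain ⟨H, hH⟩ := C.exists_weakHN hα
  have key : ∀ (μ : ℝ) (i : Fin (ℓ + 1)),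
      #{t | intervalSlope α (B.birth t) (B.death t) = μ ∧ i ∈ Icc (B.birth t) (B.death t)} =
      #{t | intervalSlope α (C.birth t) (C.death t) = μ ∧ i ∈ Icc (C.birth t) (C.death t)} :=
    fun μ i => congrFun (G.jump_eq_of_hnType_eq H (hVW α rfl) (hG μ) (hH μ)) i
  refine B.nonempty_iso_of_card_eq C fun a b hab => ?_
  rcases Fin.eq_zero_or_eq_succ a with rfl | ⟨j, hj⟩
  · rw [← B.card_eq_of_zero hα, ← C.card_eq_of_zero hα, key]
  · have h1 := B.card_eq_add hα hab hj
    have h2 := C.card_eq_add hα hab hj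
    rw [key, key] at h1
    -- The counts of bars through `a` and through its predecessor agree, so their difference, the
    -- multiplicity of `[a, b]`, agrees too.
    omega

end QuiverRep

theorem corollary4p5 {K : Type*} [Field K] (ℓ : ℕ) (α : OrdinaryQuiver ℓ → ℝ) :
    QuiverRep.IsComplete K {α} ↔
      ∀ i : Fin ℓ, α (OrdinaryQuiver.x i.castSucc) > α (OrdinaryQuiver.x i.succ) :=
  ⟨fun h i => h.lt_of_singleton i,
    fun h => QuiverRep.isComplete_singleton (Fin.strictAnti_iff_succ_lt.2 h)⟩
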